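/- Let $K$ be a compact Hausdorff space, let $\varphi : K \to K$ be a homeomorphism of $K$ onto its image $\varphi(K)$ with $\varphi(K) \subsetneq K$, let $w \in C(K)$ (complex-valued continuous functions with the supremum norm), and let $T$ be the weighted composition operator $(Tf)(k) = w(k) f(\varphi(k))$ on $C(K)$. Put $L = \bigcap_{n \ge 0} \varphi^n(K)$ and $M = K \setminus \mathrm{Int}_K L$. For a closed set $A \subseteq K$ with $\varphi(A) \subseteq A$, the same formula (for $k \in A$) defines the operator $T$ on $C(A)$; $\sigma(T, C(A))$ and $\rho(T, C(A))$ denote its spectrum and spectral radius, and $\sigma(T) = \sigma(T, C(K))$. A bounded operator is upper semi-Fredholm if its range is closed and its kernel is finite-dimensional. Let $\lambda \in \sigma(T) \setminus \{0\}$. The operator $\lambda I - T$ on $C(K)$ is upper semi-Fredholm if and only if (a) $\lambda I - T$ is upper semi-Fredholm on $C(L)$, and (b) $M$ is the union of two disjoint closed sets $M_1$, $M_2$ with $\varphi(M_i) \subseteq M_i$ ($i = 1, 2$) such that (c) if $M_1 \neq \emptyset$, then $\rho(T, C(M_1)) < |\lambda|$, and (d) if $M_2 \neq \emptyset$, then,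 with $N_2 = \bigcap_{n \ge 0} \varphi^n(M_2)$, the operator $T$ is invertible on $C(N_2)$, $|\lambda| < 1/\rho(T^{-1}, C(N_2))$, and the set $M_2 \setminus \varphi(M_2)$ is finite. Moreover, if $\lambda I - T$ is upper semi-Fredholm, then for all $M_1$, $M_2$ as in (b)–(d), $$\dim \ker(\lambda I - T) = \dim \ker(\lambda I - T, C(L)) + \mathrm{card}(M_2 \setminus \varphi(M_2)),$$ where $\ker(\lambda I - T, C(L))$ is the kernel of $\lambda I - T$ on $C(L)$. -/

import Mathlib

open Set

/-- A bounded operator is upper semi-Fredholm if its kernel is finite-dimensional and its range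
is closed. -/
def IsUpperSemiFredholm {E : Type*} [AddCommGroup E] [Module ℂ E] [TopologicalSpace E]
    (T : E →L[ℂ] E) : Prop :=
  FiniteDimensional ℂ (LinearMap.ker (T : E →ₗ[ℂ] E)) ∧ IsClosed (Set.range T)

theorem continuous_mul_left_fixed {X : Type*} [TopologicalSpace X] (w : C(X, ℂ)) :
    Continuous fun f : C(X, ℂ) => w * f := by
  refine continuous_iff_continuousAt.2 fun f => ?_
  refine (ContinuousMap.tendsto_compactOpen_iff_forall _ _).2 fun s hs => ?_
  have := isCompact_iff_compactSpace.1 hs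
  exact ((continuous_const (y := w.restrict s)).mul
    (ContinuousMap.continuous_restrict s)).tendsto f

/-- The weighted composition operator `(T f)(x) = w(x) f(φ(x))` on `C(X)`.
For compact `X` the topology of `C(X, ℂ)` is that of the supremum norm. -/
noncomputable def weightedComp {X : Type*} [TopologicalSpace X] (φ : C(X, X)) (w : C(X, ℂ)) :
    C(X, ℂ) →L[ℂ] C(X, ℂ) where
  toFun f := w * f.comp φ
  map_add' f g := by ext x; simp [mul_add]
  map_smul' c f := by ext x; simp [mul_left_comm]
  cont := (continuous_mul_left_fixed w).comp (ContinuousMap.continuous_precomp φ)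

/-- The action of `T = w T_φ` on `C(A)`, where `A` is a `φ`-invariant subset: the weighted
composition operator given by the restrictions of `φ` and `w` to `A`. -/
noncomputable def weightedCompOn {X : Type*} [TopologicalSpace X] (φ : C(X, X)) (w : C(X, ℂ))
    (A : Set X) (hA : MapsTo φ A A) : C(A, ℂ) →L[ℂ] C(A, ℂ) :=
  weightedComp ⟨hA.restrict φ A A, φ.continuous.restrict hA⟩ (w.restrict A)

/-- The set `⋂ n, φⁿ(A)`. -/
def iterInter {X : Type*} (φ : X → X) (A : Set X) : Set X :=
  ⋂ n : ℕ, φ^[n] '' A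

theorem mapsTo_iterInter {X : Type*} {φ : X → X} {A : Set X} (hA : MapsTo φ A A) :
    MapsTo φ (iterInter φ A) (iterInter φ A) := by
  intro x hx
  refine mem_iInter.2 fun n => ?_
  obtain ⟨a, ha, rfl⟩ := mem_iInter.1 hx n
  exact ⟨φ a, hA ha, by rw [← Function.iterate_succ_apply, Function.iterate_succ_apply']⟩

/-- `L = ⋂ n, φⁿ(X)`. -/
def setL {X : Type*} (φ : X → X) : Set X :=
  iterInter φ univ

theorem mapsTo_setL {X : Type*} (φ : X → X) : MapsTo φ (setL φ) (setL φ) :=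
  mapsTo_iterInter (mapsTo_univ φ univ)

/-- `M = X ∖ Int L`. -/
def setM {X : Type*} [TopologicalSpace X] (φ : X → X) : Set X :=
  (interior (setL φ))ᶜ

/-- `M = M₁ ∪ M₂` is a splitting into disjoint closed `φ`-invariant sets such that
`ρ(T, C(M₁)) < |lam|` if `M₁ ≠ ∅`, and, if `M₂ ≠ ∅`, `T` is invertible on `C(N₂)`, where
`N₂ = ⋂ n, φⁿ(M₂)`, with `|lam| < 1 / ρ(T⁻¹, C(N₂))`, and `M₂ ∖ φ(M₂)` is finite. -/
structure IsSplitting {X : Type*} [TopologicalSpace X] (φ : C(X, X)) (w : C(X, ℂ)) (lam : ℂ)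
    (M₁ M₂ : Set X) : Prop where
  union_eq : M₁ ∪ M₂ = setM φ
  disjoint : Disjoint M₁ M₂
  isClosed_left : IsClosed M₁
  isClosed_right : IsClosed M₂
  mapsTo_left : MapsTo φ M₁ M₁
  mapsTo_right : MapsTo φ M₂ M₂
  radius_left : M₁.Nonempty →
    spectralRadius ℂ (weightedCompOn φ w M₁ mapsTo_left) < ENNReal.ofReal ‖lam‖
  radius_right : M₂.Nonempty →
    ∃ u : (C(iterInter φ M₂, ℂ) →L[ℂ] C(iterInter φ M₂, ℂ))ˣ,
      (u : C(iterInter φ M₂, ℂ) →L[ℂ] C(iterInter φ M₂, ℂ)) =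
        weightedCompOn φ w (iterInter φ M₂) (mapsTo_iterInter mapsTo_right) ∧
      ENNReal.ofReal ‖lam‖ < 1 / spectralRadius ℂ
        ((u⁻¹ : (C(iterInter φ M₂, ℂ) →L[ℂ] C(iterInter φ M₂, ℂ))ˣ) :
          C(iterInter φ M₂, ℂ) →L[ℂ] C(iterInter φ M₂, ℂ))
  finite_right : M₂.Nonempty → (M₂ \ φ '' M₂).Finite

/-!
Passing to the weight `v = lam⁻¹ • w` reduces to `lam = 1`, and turns the two spectral radius
conditions into uniform decay of the products `v(x) v(φ x) ⋯ v(φⁿ⁻¹ x)` on `M₁` and their uniform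
growth on `N₂`.

Suppose a splitting is given. For `g` vanishing on `L`, the equation `f = g + v · (f ∘ φ)` has
exactly one continuous solution vanishing on `L` with a prescribed value at one point of each of
the finitely many trajectories starting in `M₂ ∖ φ(M₂)`: on `M₁` it is a Neumann series, and along
each of these trajectories, which consist of isolated points and exhaust `M₂ ∖ N₂`, it is a
recursion in which growth forces the solution to tend to `0`. So restriction to `L` maps
`ker (1 - T)` onto `ker (1 - T, C(L))` with a kernel of dimension `card (M₂ ∖ φ(M₂))`, and the range
of `1 - T` is closed if and only if its range on `C(L)` is.

Conversely, if `1 - T` is upper semi-Fredholm, it is bounded below on the functions vanishing on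
some finite set. Applying this bound twice, to `∑ (j + 1) Tʲ h` with `h` concentrated near a point
outside `L`, forces decay along all trajectories that start outside `φ(K)` and avoid the finite set.
Only finitely many other trajectories start outside `φ(K)`. Each of them either runs into the
closure of the former ones, and then decays, or consists of isolated points; in that case the same
bound, applied to functions living on the trajectory, shows that the products along it decay or grow
uniformly. The sets `M₁` and `M₂` are the closures of the unions of the decaying and of the growing
trajectories.
-/

open Filter Topology Function

/-- The cocycle `v(x) v(φ x) ⋯ v(φⁿ⁻¹ x)`: the `n`-th power of the weighted composition operator
with weight `v` is the one with weight `weightProd φ v n` over `φⁿ`. -/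
def weightProd {X : Type*} (φ : X → X) (v : X → ℂ) (n : ℕ) (x : X) : ℂ :=
  ∏ i ∈ Finset.range n, v (φ^[i] x)

section WeightProd

variable {X : Type*} {φ : X → X} {v : X → ℂ}

@[simp] theorem weightProd_zero (x : X) : weightProd φ v 0 x = 1 := Finset.prod_range_zero _

theorem weightProd_succ (n : ℕ) (x : X) :
    weightProd φ v (n + 1) x = v x * weightProd φ v n (φ x) := by
  simp [weightProd, Finset.prod_range_succ', mul_comm]

theorem weightProd_add (m n : ℕ) (x : X) :
    weightProd φ v (m + n) x = weightProd φ v m x * weightProd φ v n (φ^[m] x) := by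
  simp only [weightProd, Finset.prod_range_add, ← iterate_add_apply, add_comm _ m]

theorem weightProd_const_mul (c : ℂ) (n : ℕ) (x : X) :
    weightProd φ (fun y => c * v y) n x = c ^ n * weightProd φ v n x := by
  simp [weightProd, Finset.prod_mul_distrib]

theorem weightProd_restrict {A : Set X} (hA : MapsTo φ A A) (n : ℕ) (x : A) :
    weightProd (hA.restrict φ A A) (fun y => v y) n x = weightProd φ v n x :=
  Finset.prod_congr rfl fun i _ => by rw [hA.iterate_restrict]; rfl

theorem weightProd_trajectory (p : X) (n j : ℕ) :
    weightProd Nat.succ (fun i => v (φ^[i] p)) n j = weightProd φ v n (φ^[j] p) := by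
  simp only [weightProd, Nat.succ_iterate, ← iterate_add_apply, add_comm]

theorem continuous_weightProd [TopologicalSpace X] (hφ : Continuous φ) (hv : Continuous v)
    (n : ℕ) : Continuous (weightProd φ v n) :=
  continuous_finsetProd _ fun i _ => hv.comp (hφ.iterate i)

theorem norm_weightProd_le_pow {B : ℝ} (hB : ∀ x, ‖v x‖ ≤ B) (n : ℕ) (x : X) :
    ‖weightProd φ v n x‖ ≤ B ^ n := by
  rw [weightProd, norm_prod]
  exact (Finset.prod_le_prod (fun _ _ => norm_nonneg _) fun _ _ => hB _).trans_eq (by simp)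

theorem eq_sum_weightProd_of_eq_add_mul {A : Set X} (hA : MapsTo φ A A) {f g : X → ℂ}
    (h : ∀ x ∈ A, f x = g x + v x * f (φ x)) (n : ℕ) {x : X} (hx : x ∈ A) :
    f x = ∑ i ∈ Finset.range n, weightProd φ v i x * g (φ^[i] x) +
      weightProd φ v n x * f (φ^[n] x) := by
  induction n with
  | zero => simp
  | succ n ih =>
    rw [ih, h _ (hA.iterate n hx), Finset.sum_range_succ, weightProd_add, iterate_succ_apply',
      weightProd_succ, weightProd_zero]
    ring

theorem eq_weightProd_mul_of_eq_mul {A : Set X} (hA : MapsTo φ A A) {f : X → ℂ}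
    (h : ∀ x ∈ A, f x = v x * f (φ x)) (n : ℕ) {x : X} (hx : x ∈ A) :
    f x = weightProd φ v n x * f (φ^[n] x) := by
  simpa using eq_sum_weightProd_of_eq_add_mul hA (g := 0) (by simpa using h) n hx

end WeightProd

/-- The products `weightProd φ v n` converge to `0` uniformly on `A`. -/
def UniformDecay {X : Type*} (φ : X → X) (v : X → ℂ) (A : Set X) : Prop :=
  ∀ ε > 0, ∀ᶠ n in atTop, ∀ x ∈ A, ‖weightProd φ v n x‖ ≤ ε

/-- The products `weightProd φ v n` converge to infinity uniformly on `A`. -/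
def UniformGrowth {X : Type*} (φ : X → X) (v : X → ℂ) (A : Set X) : Prop :=
  ∀ R : ℝ, ∀ᶠ n in atTop, ∀ x ∈ A, R ≤ ‖weightProd φ v n x‖

section Uniform

variable {X : Type*} {φ : X → X} {v : X → ℂ} {A B : Set X}

theorem UniformDecay.mono (h : UniformDecay φ v B) (hAB : A ⊆ B) : UniformDecay φ v A :=
  fun ε hε => (h ε hε).mono fun _ hn x hx => hn x (hAB hx)

theorem UniformGrowth.mono (h : UniformGrowth φ v B) (hAB : A ⊆ B) : UniformGrowth φ v A :=
  fun R => (h R).mono fun _ hn x hx => hn x (hAB hx)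

theorem UniformDecay.union (hA : UniformDecay φ v A) (hB : UniformDecay φ v B) :
    UniformDecay φ v (A ∪ B) :=
  fun ε hε => ((hA ε hε).and (hB ε hε)).mono fun _ hn => forall₂_or_left.2 hn

theorem UniformDecay.biUnion {ι : Type*} {s : Set ι} (hs : s.Finite) {A : ι → Set X}
    (h : ∀ i ∈ s, UniformDecay φ v (A i)) : UniformDecay φ v (⋃ i ∈ s, A i) := fun ε hε =>
  ((eventually_all_finite hs).2 fun i hi => h i hi ε hε).mono fun _ hn x hx => by
    obtain ⟨i, hi, hx⟩ := mem_iUnion₂.1 hx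
    exact hn i hi x hx

theorem UniformGrowth.biUnion {ι : Type*} {s : Set ι} (hs : s.Finite) {A : ι → Set X}
    (h : ∀ i ∈ s, UniformGrowth φ v (A i)) : UniformGrowth φ v (⋃ i ∈ s, A i) := fun R =>
  ((eventually_all_finite hs).2 fun i hi => h i hi R).mono fun _ hn x hx => by
    obtain ⟨i, hi, hx⟩ := mem_iUnion₂.1 hx
    exact hn i hi x hx

theorem UniformDecay.closure [TopologicalSpace X] (hφ : Continuous φ) (hv : Continuous v)
    (h : UniformDecay φ v A) : UniformDecay φ v (closure A) := fun ε hε =>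
  (h ε hε).mono fun n hn => closure_minimal hn
    (isClosed_le (continuous_weightProd hφ hv n).norm continuous_const)

theorem UniformGrowth.closure [TopologicalSpace X] (hφ : Continuous φ) (hv : Continuous v)
    (h : UniformGrowth φ v A) : UniformGrowth φ v (closure A) := fun R =>
  (h R).mono fun n hn => closure_minimal hn
    (isClosed_le continuous_const (continuous_weightProd hφ hv n).norm)

theorem UniformDecay.of_image_iterate {C : ℝ} (hC : ∀ x, ‖v x‖ ≤ C) (k : ℕ)
    (h : UniformDecay φ v (φ^[k] '' A)) : UniformDecay φ v A := by
  intro ε hε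
  have hpos : 0 < |C| ^ k + 1 := by positivity
  filter_upwards [(tendsto_sub_atTop_nat k).eventually (h (ε / (|C| ^ k + 1)) (by positivity)),
    eventually_ge_atTop k] with n hn hkn x hx
  have hhead : ‖weightProd φ v k x‖ ≤ |C| ^ k + 1 :=
    (norm_weightProd_le_pow (fun x => (hC x).trans (le_abs_self C)) k x).trans (by linarith)
  calc ‖weightProd φ v n x‖
      = ‖weightProd φ v k x‖ * ‖weightProd φ v (n - k) (φ^[k] x)‖ := by
        rw [← norm_mul, ← weightProd_add, Nat.add_sub_cancel' hkn]
    _ ≤ (|C| ^ k + 1) * (ε / (|C| ^ k + 1)) := by gcongr; exact hn _ (mem_image_of_mem _ hx)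
    _ = ε := mul_div_cancel₀ ε hpos.ne'

theorem UniformDecay.disjoint_of_uniformGrowth (hA : UniformDecay φ v A)
    (hB : UniformGrowth φ v B) : Disjoint A B := by
  refine Set.disjoint_left.2 fun x hxA hxB => ?_
  obtain ⟨n, hle, hge⟩ := ((hA 1 one_pos).and (hB 2)).exists
  linarith [hle x hxA, hge x hxB]

theorem UniformGrowth.ne_zero (h : UniformGrowth φ v A) {x : X} (hx : x ∈ A) : v x ≠ 0 := by
  intro h0
  obtain ⟨n, hn⟩ := ((tendsto_add_atTop_nat 1).eventually (h 1)).exists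
  have := hn x hx
  rw [weightProd_succ, h0, zero_mul, norm_zero] at this
  linarith

theorem uniformDecay_restrict_univ_iff (hA : MapsTo φ A A) :
    UniformDecay (hA.restrict φ A A) (fun x => v x) univ ↔ UniformDecay φ v A := by
  simp only [UniformDecay, mem_univ, forall_const, weightProd_restrict, Subtype.forall]

theorem uniformGrowth_restrict_univ_iff (hA : MapsTo φ A A) :
    UniformGrowth (hA.restrict φ A A) (fun x => v x) univ ↔ UniformGrowth φ v A := by
  simp only [UniformGrowth, mem_univ, forall_const, weightProd_restrict, Subtype.forall]

theorem UniformDecay.eq_zero_of_eq_mul [TopologicalSpace X] (h : UniformDecay φ v A)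
    (hA : MapsTo φ A A) (hAc : IsCompact A) {f : X → ℂ} (hf : ContinuousOn f A)
    (heq : ∀ x ∈ A, f x = v x * f (φ x)) {x : X} (hx : x ∈ A) : f x = 0 := by
  obtain ⟨y, hy, hmax⟩ := hAc.exists_isMaxOn ⟨x, hx⟩ hf.norm
  obtain ⟨n, hn⟩ := (h (1 / 2) one_half_pos).exists
  have hhalf : ‖f y‖ ≤ 1 / 2 * ‖f y‖ :=
    calc ‖f y‖ = ‖weightProd φ v n y‖ * ‖f (φ^[n] y)‖ := by
          rw [← norm_mul, ← eq_weightProd_mul_of_eq_mul hA heq n hy]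
      _ ≤ 1 / 2 * ‖f y‖ := by
          gcongr
          exacts [hn y hy, hmax (hA.iterate n hy)]
  have hxy : ‖f x‖ ≤ ‖f y‖ := hmax hx
  exact norm_le_zero_iff.1 (by linarith)

end Uniform

section SpectralRadius

variable {E : Type*} [NormedRing E] [NormedAlgebra ℂ E] [CompleteSpace E] {a : E} {r : ℝ}

theorem pow_isLittleO_of_spectralRadius_lt (h : spectralRadius ℂ a < ENNReal.ofReal r) :
    (fun n : ℕ => a ^ n) =o[atTop] fun n => r ^ n := by
  obtain ⟨s, has, hsr⟩ := ENNReal.lt_iff_exists_nnreal_btwn.1 h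
  have hsr' : (s : ℝ) < r := by
    rwa [← ENNReal.ofReal_coe_nnreal, ENNReal.ofReal_lt_ofReal_iff_of_nonneg s.coe_nonneg] at hsr
  refine Asymptotics.IsBigO.trans_isLittleO (.of_bound' ?_)
    (isLittleO_pow_pow_of_lt_left s.coe_nonneg hsr')
  filter_upwards [eventually_gt_atTop 0,
    (spectrum.pow_nnnorm_pow_one_div_tendsto_nhds_spectralRadius a).eventually_lt_const has]
    with n hn0 hn
  rw [one_div, ENNReal.rpow_inv_lt_iff (by exact_mod_cast hn0), ENNReal.rpow_natCast] at hn
  rw [Real.norm_of_nonneg (pow_nonneg s.coe_nonneg n)]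
  exact_mod_cast hn.le

theorem spectralRadius_lt_of_pow_isLittleO (hr : 0 < r)
    (h : (fun n : ℕ => a ^ n) =o[atTop] fun n => r ^ n) :
    spectralRadius ℂ a < ENNReal.ofReal r := by
  obtain ⟨n, hn⟩ := (tendsto_add_atTop_nat 1).eventually
    (h.bound (c := (‖(1 : E)‖ + 1)⁻¹) (by positivity)) |>.exists
  have hlt : ‖a ^ (n + 1)‖ * ‖(1 : E)‖ < r ^ (n + 1) := by
    rw [Real.norm_of_nonneg (pow_pos hr _).le, ← div_eq_inv_mul, le_div_iff₀ (by positivity)] at hn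
    rcases (norm_nonneg (a ^ (n + 1))).eq_or_lt with h0 | h0
    · rw [← h0, zero_mul]
      positivity
    · linarith
  have hlt' : (‖a ^ (n + 1)‖₊ * ‖(1 : E)‖₊ : ENNReal) < ENNReal.ofReal r ^ (n + 1) := by
    rw [← ENNReal.ofReal_pow hr.le, ← ENNReal.coe_mul, ← ENNReal.ofReal_coe_nnreal]
    exact (ENNReal.ofReal_lt_ofReal_iff (by positivity)).2 (by exact_mod_cast hlt)
  refine (spectrum.spectralRadius_le_pow_nnnorm_pow_one_div ℂ a n).trans_lt ?_
  rw [← ENNReal.mul_rpow_of_nonneg _ _ (by positivity), one_div,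
    ENNReal.rpow_inv_lt_iff (by positivity)]
  exact_mod_cast hlt'

theorem spectralRadius_lt_ofReal_iff (hr : 0 < r) : spectralRadius ℂ a < ENNReal.ofReal r ↔
    ∀ ε > 0, ∀ᶠ n : ℕ in atTop, ‖a ^ n‖ ≤ ε * r ^ n := by
  have h : spectralRadius ℂ a < ENNReal.ofReal r ↔ (fun n : ℕ => a ^ n) =o[atTop] fun n => r ^ n :=
    ⟨pow_isLittleO_of_spectralRadius_lt, spectralRadius_lt_of_pow_isLittleO hr⟩
  simpa only [Asymptotics.isLittleO_iff, Real.norm_of_nonneg (pow_pos hr _).le] using h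

end SpectralRadius

section WeightedComp

variable {X : Type*} [TopologicalSpace X] (φ : C(X, X)) (w : C(X, ℂ))

@[simp] theorem weightedComp_apply (f : C(X, ℂ)) (x : X) :
    weightedComp φ w f x = w x * f (φ x) := rfl

theorem weightedComp_pow_apply (n : ℕ) (f : C(X, ℂ)) (x : X) :
    (weightedComp φ w ^ n) f x = weightProd φ w n x * f (φ^[n] x) := by
  induction n generalizing x with
  | zero => simp
  | succ n ih =>
    rw [pow_succ', mul_apply_eq_comp, weightedComp_apply, ih, weightProd_succ,
      iterate_succ_apply, mul_assoc]

theorem weightProd_smul_eq (c : ℂ) (n : ℕ) (x : X) :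
    weightProd φ (c • w : C(X, ℂ)) n x = c ^ n * weightProd φ w n x :=
  weightProd_const_mul c n x

variable {φ w} [CompactSpace X]

theorem norm_weightedComp_pow_le_iff {C : ℝ} (hC : 0 ≤ C) (n : ℕ) :
    ‖weightedComp φ w ^ n‖ ≤ C ↔ ∀ x, ‖weightProd φ w n x‖ ≤ C := by
  refine ⟨fun h x => ?_, fun h => ContinuousLinearMap.opNorm_le_bound _ hC fun f =>
    (ContinuousMap.norm_le _ (by positivity)).2 fun x => ?_⟩
  · have hone : ‖(1 : C(X, ℂ))‖ ≤ 1 := (ContinuousMap.norm_le _ zero_le_one).2 (by simp)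
    calc ‖weightProd φ w n x‖ = ‖(weightedComp φ w ^ n) 1 x‖ := by
          rw [weightedComp_pow_apply, ContinuousMap.one_apply, mul_one]
      _ ≤ ‖(weightedComp φ w ^ n) 1‖ := ContinuousMap.norm_coe_le_norm _ x
      _ ≤ C := (ContinuousLinearMap.le_of_opNorm_le_of_le _ h hone).trans_eq (mul_one C)
  · rw [weightedComp_pow_apply, norm_mul]
    gcongr
    exacts [h x, f.norm_coe_le_norm _]

theorem norm_inv_pow_le_iff (hφ : Surjective φ) {u : (C(X, ℂ) →L[ℂ] C(X, ℂ))ˣ}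
    (hu : (u : C(X, ℂ) →L[ℂ] C(X, ℂ)) = weightedComp φ w) {C : ℝ} (hC : 0 ≤ C) (n : ℕ) :
    ‖(↑u⁻¹ : C(X, ℂ) →L[ℂ] C(X, ℂ)) ^ n‖ ≤ C ↔ ∀ x, 1 ≤ C * ‖weightProd φ w n x‖ := by
  have hinv (g : C(X, ℂ)) (x : X) :
      ‖weightProd φ w n x‖ * ‖((↑u⁻¹ : C(X, ℂ) →L[ℂ] C(X, ℂ)) ^ n) g (φ^[n] x)‖ = ‖g x‖ := by
    rw [← norm_mul, ← weightedComp_pow_apply, ← hu, ← mul_apply_eq_comp, ← Units.val_pow_eq_pow_val,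
      ← Units.val_pow_eq_pow_val, inv_pow, Units.mul_inv, one_apply_eq_self]
  refine ⟨fun h x => ?_, fun h => ContinuousLinearMap.opNorm_le_bound _ hC fun g =>
    (ContinuousMap.norm_le _ (by positivity)).2 fun y => ?_⟩
  · have hone : ‖(1 : C(X, ℂ))‖ ≤ 1 := (ContinuousMap.norm_le _ zero_le_one).2 (by simp)
    calc (1 : ℝ) = ‖weightProd φ w n x‖ *
          ‖((↑u⁻¹ : C(X, ℂ) →L[ℂ] C(X, ℂ)) ^ n) 1 (φ^[n] x)‖ := by
          rw [hinv, ContinuousMap.one_apply, norm_one]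
      _ ≤ ‖weightProd φ w n x‖ * C := by
        gcongr
        exact (ContinuousMap.norm_coe_le_norm _ _).trans
          ((ContinuousLinearMap.le_of_opNorm_le_of_le _ h hone).trans_eq (mul_one C))
      _ = C * ‖weightProd φ w n x‖ := mul_comm _ _
  · obtain ⟨x, rfl⟩ := hφ.iterate n y
    set b := ‖((↑u⁻¹ : C(X, ℂ) →L[ℂ] C(X, ℂ)) ^ n) g (φ^[n] x)‖ with hb
    calc b ≤ C * ‖weightProd φ w n x‖ * b := le_mul_of_one_le_left (norm_nonneg _) (h x)
      _ = C * ‖g x‖ := by rw [mul_assoc, hb, hinv]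
      _ ≤ C * ‖g‖ := by gcongr; exact g.norm_coe_le_norm x

theorem spectralRadius_weightedComp_lt_iff {c : ℂ} (hc : c ≠ 0) :
    spectralRadius ℂ (weightedComp φ w) < ENNReal.ofReal ‖c‖ ↔
      UniformDecay φ (c⁻¹ • w : C(X, ℂ)) univ := by
  have hc' : 0 < ‖c‖ := norm_pos_iff.2 hc
  refine (spectralRadius_lt_ofReal_iff (E := C(X, ℂ) →L[ℂ] C(X, ℂ)) hc').trans
    (forall₂_congr fun ε hε => eventually_congr (.of_forall fun n => ?_))
  refine (norm_weightedComp_pow_le_iff (by positivity) n).trans (forall_congr' fun x => ?_)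
  rw [weightProd_smul_eq, norm_mul, norm_pow, norm_inv, inv_pow,
    inv_mul_le_iff₀ (pow_pos hc' n), mul_comm, forall_prop_of_true (mem_univ x)]

theorem ofReal_lt_one_div_spectralRadius_inv_iff (hφ : Surjective φ) {c : ℂ} (hc : c ≠ 0)
    {u : (C(X, ℂ) →L[ℂ] C(X, ℂ))ˣ} (hu : (u : C(X, ℂ) →L[ℂ] C(X, ℂ)) = weightedComp φ w) :
    ENNReal.ofReal ‖c‖ < 1 / spectralRadius ℂ (↑u⁻¹ : C(X, ℂ) →L[ℂ] C(X, ℂ)) ↔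
      UniformGrowth φ (c⁻¹ • w : C(X, ℂ)) univ := by
  have hc' : 0 < ‖c‖ := norm_pos_iff.2 hc
  rw [one_div, ENNReal.lt_inv_iff_lt_inv, ← ENNReal.ofReal_inv_of_pos hc']
  have hpow (ε : ℝ) (hε : 0 < ε) (n : ℕ) :
      ‖(↑u⁻¹ : C(X, ℂ) →L[ℂ] C(X, ℂ)) ^ n‖ ≤ ε * ‖c‖⁻¹ ^ n ↔
        ∀ x ∈ univ, ε⁻¹ ≤ ‖weightProd φ (c⁻¹ • w : C(X, ℂ)) n x‖ := by
    refine (norm_inv_pow_le_iff hφ hu (by positivity) n).trans (forall_congr' fun x => ?_)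
    rw [weightProd_smul_eq, norm_mul, norm_pow, norm_inv, inv_le_iff_one_le_mul₀' hε, mul_assoc,
      forall_prop_of_true (mem_univ x)]
  refine (spectralRadius_lt_ofReal_iff (E := C(X, ℂ) →L[ℂ] C(X, ℂ)) (inv_pos.2 hc')).trans
    ⟨fun h R => ?_, fun h ε hε => ?_⟩
  · refine (h (|R| + 1)⁻¹ (by positivity)).mono fun n hn x hx => ?_
    have := (hpow _ (by positivity) n).1 hn x hx
    rw [inv_inv] at this
    linarith [le_abs_self R]
  · exact (h ε⁻¹).mono fun n => (hpow ε hε n).2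

theorem isUnit_weightedComp [T2Space X] (hφ : Bijective φ) (hw : ∀ x, w x ≠ 0) :
    IsUnit (weightedComp φ w) := by
  let e : X ≃ₜ X := Continuous.homeoOfEquivCompactToT2 (f := Equiv.ofBijective φ hφ) φ.continuous
  have hright (x : X) : φ (e.symm x) = x := e.apply_symm_apply x
  have hleft (x : X) : e.symm (φ x) = x := e.symm_apply_apply x
  let w' : C(X, ℂ) :=
    ⟨fun x => (w (e.symm x))⁻¹, (w.continuous.comp e.symm.continuous).inv₀ fun _ => hw _⟩
  have hw' (x : X) : w' x = (w (e.symm x))⁻¹ := rfl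
  refine ⟨⟨weightedComp φ w, weightedComp e.symm w', ?_, ?_⟩, rfl⟩ <;> ext f x
  · simp [hw', hleft, hw]
  · simp [hw', hright, hw]

theorem exists_unit_eq_weightedComp_and_lt_iff [T2Space X] (hφ : Bijective φ) {c : ℂ}
    (hc : c ≠ 0) :
    (∃ u : (C(X, ℂ) →L[ℂ] C(X, ℂ))ˣ, (u : C(X, ℂ) →L[ℂ] C(X, ℂ)) = weightedComp φ w ∧
      ENNReal.ofReal ‖c‖ < 1 / spectralRadius ℂ (↑u⁻¹ : C(X, ℂ) →L[ℂ] C(X, ℂ))) ↔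
      UniformGrowth φ (c⁻¹ • w : C(X, ℂ)) univ := by
  refine ⟨fun ⟨u, hu, h⟩ => (ofReal_lt_one_div_spectralRadius_inv_iff hφ.2 hc hu).1 h, fun h => ?_⟩
  obtain ⟨u, hu⟩ := isUnit_weightedComp (w := w) hφ fun x =>
    right_ne_zero_of_mul (h.ne_zero (mem_univ x) : c⁻¹ * w x ≠ 0)
  exact ⟨u, hu, (ofReal_lt_one_div_spectralRadius_inv_iff hφ.2 hc hu).2 h⟩

end WeightedComp

/-- The forward trajectory `{x, φ x, φ² x, …}`. -/
def trajectory {X : Type*} (φ : X → X) (x : X) : Set X :=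
  range fun n : ℕ => φ^[n] x

section Trajectories

variable {X : Type*} {φ : X → X} {A : Set X}

theorem mapsTo_trajectory (x : X) : MapsTo φ (trajectory φ x) (trajectory φ x) := by
  rintro _ ⟨n, rfl⟩
  exact ⟨n + 1, iterate_succ_apply' φ n x⟩

theorem trajectory_subset (hA : MapsTo φ A A) {x : X} (hx : x ∈ A) : trajectory φ x ⊆ A :=
  range_subset_iff.2 fun n => hA.iterate n hx

theorem iterate_notMem_image_succ (hφ : Injective φ) {p : X} (hp : p ∉ φ '' A) (n : ℕ) :
    φ^[n] p ∉ φ^[n + 1] '' A := by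
  rintro ⟨q, hq, h⟩
  rw [iterate_succ_apply] at h
  exact hp ⟨q, hq, hφ.iterate n h⟩

theorem iterate_inj_of_notMem_image (hφ : Injective φ) (hA : MapsTo φ A A) {p q : X}
    (hp : p ∈ A \ φ '' A) (hq : q ∈ A \ φ '' A) {m n : ℕ} (h : φ^[m] p = φ^[n] q) :
    p = q ∧ m = n := by
  wlog hmn : m ≤ n generalizing p q m n
  · have := this hq hp h.symm (by omega)
    exact ⟨this.1.symm, this.2.symm⟩
  obtain ⟨k, rfl⟩ := Nat.exists_eq_add_of_le hmn
  have h : p = φ^[k] q := hφ.iterate m (by rw [h, iterate_add_apply])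
  rcases k with _ | k
  · exact ⟨h, rfl⟩
  · exact absurd ⟨φ^[k] q, hA.iterate k hq.1, by rw [h, iterate_succ_apply']⟩ hp.2

theorem antitone_image_iterate (hA : MapsTo φ A A) : Antitone fun n : ℕ => φ^[n] '' A := by
  refine antitone_nat_of_succ_le fun n => ?_
  rintro _ ⟨a, ha, rfl⟩
  exact ⟨φ a, hA ha, (iterate_succ_apply _ _ _).symm⟩

theorem iterate_mem_image_iterate (hA : MapsTo φ A A) {x : X} (hx : x ∈ A) {m n : ℕ}
    (hmn : m ≤ n) : φ^[n] x ∈ φ^[m] '' A :=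
  antitone_image_iterate hA hmn (mem_image_of_mem _ hx)

theorem iterInter_subset_setL : iterInter φ A ⊆ setL φ :=
  iInter_mono fun _ => image_mono (subset_univ A)

theorem bijective_restrict_iterInter (hφ : Injective φ) (hA : MapsTo φ A A) :
    Bijective ((mapsTo_iterInter hA).restrict φ (iterInter φ A) (iterInter φ A)) := by
  refine ⟨(mapsTo_iterInter hA).restrict_inj.2 hφ.injOn, (MapsTo.restrict_surjective_iff _).2 ?_⟩
  intro x hx
  obtain ⟨y, -, rfl⟩ := mem_iInter.1 hx 1
  refine ⟨y, mem_iInter.2 fun n => ?_, rfl⟩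
  obtain ⟨z, hz, h⟩ := mem_iInter.1 hx (n + 1)
  exact ⟨z, hz, hφ ((iterate_succ_apply' φ n z).symm.trans h)⟩

theorem diff_iterInter_eq_biUnion_trajectory (hφ : Injective φ) (hA : MapsTo φ A A) :
    A \ iterInter φ A = ⋃ p ∈ A \ φ '' A, trajectory φ p := by
  classical
  ext x
  simp only [mem_iUnion₂, iterInter, Set.mem_sdiff, mem_iInter, not_forall]
  constructor
  · rintro ⟨hx, h⟩
    obtain ⟨k, hk⟩ := Nat.exists_eq_succ_of_ne_zero (n := Nat.find h)
      fun h0 => Nat.find_spec h (by rw [h0]; simpa using hx)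
    obtain ⟨p, hp, rfl⟩ : x ∈ φ^[k] '' A := not_not.1 (Nat.find_min h (by omega))
    refine ⟨p, ⟨hp, ?_⟩, k, rfl⟩
    rintro ⟨q, hq, rfl⟩
    exact Nat.find_spec h (by rw [hk]; exact ⟨q, hq, rfl⟩)
  · rintro ⟨p, ⟨hp, hp'⟩, n, rfl⟩
    exact ⟨hA.iterate n hp, n + 1, iterate_notMem_image_succ hφ hp' n⟩

theorem finite_diff_image_iterate (h : (A \ φ '' A).Finite) (n : ℕ) :
    (A \ φ^[n] '' A).Finite := by
  induction n with
  | zero => simp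
  | succ n ih =>
    refine (h.union (ih.image φ)).subset ?_
    rintro x ⟨hx, hx'⟩
    by_cases hx1 : x ∈ φ '' A
    · obtain ⟨y, hy, rfl⟩ := hx1
      refine Or.inr ⟨y, ⟨hy, ?_⟩, rfl⟩
      rintro ⟨z, hz, rfl⟩
      exact hx' ⟨z, hz, iterate_succ_apply' _ _ _⟩
    · exact Or.inl ⟨hx, hx1⟩

variable [TopologicalSpace X]

theorem setM_eq_closure : setM φ = closure (setL φ)ᶜ := closure_compl.symm

theorem mem_setM_of_notMem_setL {x : X} (hx : x ∉ setL φ) : x ∈ setM φ :=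
  setM_eq_closure (φ := φ) ▸ subset_closure hx

variable [CompactSpace X] [T2Space X]

theorem isClosed_iterInter (hφ : Continuous φ) (hA : IsClosed A) : IsClosed (iterInter φ A) :=
  isClosed_iInter fun n => (hA.isCompact.image (hφ.iterate n)).isClosed

theorem isClosed_setL (hφ : Continuous φ) : IsClosed (setL φ) :=
  isClosed_iterInter hφ isClosed_univ

theorem exists_image_iterate_subset (hφ : Continuous φ) (hA : IsClosed A) (hAφ : MapsTo φ A A)
    {U : Set X} (hU : IsOpen U) (h : iterInter φ A ⊆ U) : ∃ n : ℕ, φ^[n] '' A ⊆ U :=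
  exists_subset_nhds_of_isCompact (antitone_image_iterate hAφ).directed_ge
    (fun n => hA.isCompact.image (hφ.iterate n)) fun _ hx => hU.mem_nhds (h hx)

end Trajectories

/-- The dynamical content of `IsSplitting`: the two bounds on spectral radii are replaced by uniform
decay of the weight products on `M₁` and uniform growth on `⋂ n, φⁿ(M₂)`. -/
structure IsHyperbolicSplitting {X : Type*} [TopologicalSpace X] (φ : X → X) (v : X → ℂ)
    (M₁ M₂ : Set X) : Prop where
  union_eq : M₁ ∪ M₂ = setM φ
  disjoint : Disjoint M₁ M₂
  isClosed_left : IsClosed M₁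
  isClosed_right : IsClosed M₂
  mapsTo_left : MapsTo φ M₁ M₁
  mapsTo_right : MapsTo φ M₂ M₂
  decay : UniformDecay φ v M₁
  growth : UniformGrowth φ v (iterInter φ M₂)
  finite_diff : (M₂ \ φ '' M₂).Finite

theorem IsHyperbolicSplitting.mem_or_mem {X : Type*} [TopologicalSpace X] {φ : X → X} {v : X → ℂ}
    {M₁ M₂ : Set X} (h : IsHyperbolicSplitting φ v M₁ M₂) {x : X} (hx : x ∉ setL φ) :
    x ∈ M₁ ∨ x ∈ M₂ :=
  h.union_eq.ge (mem_setM_of_notMem_setL hx)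

section IsSplitting

variable {X : Type*} [TopologicalSpace X] [CompactSpace X] {φ : C(X, X)} {w : C(X, ℂ)} {c : ℂ}
  {A : Set X}

theorem spectralRadius_weightedCompOn_lt_iff (hc : c ≠ 0) (hA : MapsTo φ A A)
    (hAc : IsClosed A) :
    spectralRadius ℂ (weightedCompOn φ w A hA) < ENNReal.ofReal ‖c‖ ↔
      UniformDecay φ (c⁻¹ • w : C(X, ℂ)) A := by
  have := isCompact_iff_compactSpace.1 hAc.isCompact
  rw [weightedCompOn, spectralRadius_weightedComp_lt_iff hc]
  exact uniformDecay_restrict_univ_iff (v := (c⁻¹ • w : C(X, ℂ))) hA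

variable [T2Space X]

theorem exists_unit_eq_weightedCompOn_iterInter_and_lt_iff (hφ : Injective φ) (hc : c ≠ 0)
    (hA : MapsTo φ A A) (hAc : IsClosed A) :
    (∃ u : (C(iterInter φ A, ℂ) →L[ℂ] C(iterInter φ A, ℂ))ˣ,
      (u : C(iterInter φ A, ℂ) →L[ℂ] C(iterInter φ A, ℂ)) =
        weightedCompOn φ w (iterInter φ A) (mapsTo_iterInter hA) ∧
      ENNReal.ofReal ‖c‖ < 1 / spectralRadius ℂ
        (↑u⁻¹ : C(iterInter φ A, ℂ) →L[ℂ] C(iterInter φ A, ℂ))) ↔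
      UniformGrowth φ (c⁻¹ • w : C(X, ℂ)) (iterInter φ A) := by
  have := isCompact_iff_compactSpace.1 (isClosed_iterInter φ.continuous hAc).isCompact
  rw [weightedCompOn,
    exists_unit_eq_weightedComp_and_lt_iff (bijective_restrict_iterInter hφ hA) hc]
  exact uniformGrowth_restrict_univ_iff (v := (c⁻¹ • w : C(X, ℂ))) (mapsTo_iterInter hA)

theorem isSplitting_iff_isHyperbolicSplitting (hφ : Injective φ) (hc : c ≠ 0) {M₁ M₂ : Set X} :
    IsSplitting φ w c M₁ M₂ ↔ IsHyperbolicSplitting φ (c⁻¹ • w : C(X, ℂ)) M₁ M₂ := by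
  constructor
  · rintro ⟨hunion, hdisj, h₁c, h₂c, h₁, h₂, hleft, hright, hfin⟩
    refine ⟨hunion, hdisj, h₁c, h₂c, h₁, h₂, ?_, ?_, ?_⟩
    · rcases M₁.eq_empty_or_nonempty with rfl | hne
      · simp [UniformDecay]
      · exact (spectralRadius_weightedCompOn_lt_iff hc h₁ h₁c).1 (hleft hne)
    · rcases M₂.eq_empty_or_nonempty with rfl | hne
      · simp [UniformGrowth, iterInter]
      · exact (exists_unit_eq_weightedCompOn_iterInter_and_lt_iff hφ hc h₂ h₂c).1 (hright hne)
    · rcases M₂.eq_empty_or_nonempty with rfl | hne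
      · simp
      · exact hfin hne
  · rintro ⟨hunion, hdisj, h₁c, h₂c, h₁, h₂, hdecay, hgrowth, hfin⟩
    exact ⟨hunion, hdisj, h₁c, h₂c, h₁, h₂,
      fun _ => (spectralRadius_weightedCompOn_lt_iff hc h₁ h₁c).2 hdecay,
      fun _ => (exists_unit_eq_weightedCompOn_iterInter_and_lt_iff hφ hc h₂ h₂c).2 hgrowth,
      fun _ => hfin⟩

end IsSplitting

section Sequences

theorem tendsto_zero_of_add_le_mul_add {a b : ℕ → ℝ} {n : ℕ} (hn : n ≠ 0) {c : ℝ} (hc0 : 0 ≤ c)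
    (hc1 : c < 1) (ha : ∀ j, 0 ≤ a j) (hb : Tendsto b atTop (𝓝 0))
    (h : ∀ᶠ j in atTop, a (j + n) ≤ c * a j + b j) : Tendsto a atTop (𝓝 0) := by
  refine tendsto_order.2 ⟨fun ε hε => Eventually.of_forall fun j => hε.trans_le (ha j),
    fun ε hε => ?_⟩
  obtain ⟨J, hJ⟩ := eventually_atTop.1 (h.and
    (hb.eventually_lt_const (mul_pos (half_pos hε) (sub_pos.2 hc1))))
  set s := ∑ r ∈ Finset.range n, a (J + r)
  have hclass : ∀ k, ∀ r < n, a (J + r + k * n) ≤ ε / 2 + c ^ k * s := by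
    intro k r hr
    induction k with
    | zero =>
      have : a (J + r) ≤ s := Finset.single_le_sum (f := fun r => a (J + r)) (fun i _ => ha _)
        (Finset.mem_range.2 hr)
      simp only [zero_mul, add_zero, pow_zero, one_mul]
      linarith
    | succ k ih =>
      obtain ⟨hstep, hsmall⟩ := hJ (J + r + k * n) (by omega)
      calc a (J + r + (k + 1) * n) = a (J + r + k * n + n) := by congr 1; ring
        _ ≤ c * (ε / 2 + c ^ k * s) + ε / 2 * (1 - c) :=
          hstep.trans (add_le_add (mul_le_mul_of_nonneg_left ih hc0) hsmall.le)
        _ = ε / 2 + c ^ (k + 1) * s := by ring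
  have hlim : Tendsto (fun j => c ^ ((j - J) / n) * s) atTop (𝓝 0) := by
    simpa using (((tendsto_pow_atTop_nhds_zero_of_lt_one hc0 hc1).comp
      (Nat.tendsto_div_const_atTop hn)).comp (tendsto_sub_atTop_nat J)).mul_const s
  filter_upwards [hlim.eventually_lt_const (half_pos hε), eventually_ge_atTop J] with j hj hJj
  have hdiv : J + (j - J) % n + (j - J) / n * n = j := by
    have := Nat.mod_add_div' (j - J) n
    omega
  have := hclass ((j - J) / n) ((j - J) % n) (Nat.mod_lt _ (by omega))
  rw [hdiv] at this
  linarith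

theorem tendsto_zero_of_eq_add_mul {f g w : ℕ → ℂ} {n : ℕ} {C : ℝ} (hC : ∀ j, ‖w j‖ ≤ C)
    (hw : ∀ᶠ j in atTop, 2 ≤ ‖weightProd Nat.succ w n j‖) (hg : Tendsto g atTop (𝓝 0))
    (hf : ∀ j, f j = g j + w j * f (j + 1)) : Tendsto f atTop (𝓝 0) := by
  have hn : n ≠ 0 := by
    rintro rfl
    obtain ⟨j, hj⟩ := hw.exists
    norm_num at hj
  set G : ℕ → ℂ := fun j => ∑ i ∈ Finset.range n, weightProd Nat.succ w i j * g (j + i)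
  have hiter : ∀ j, f j = G j + weightProd Nat.succ w n j * f (j + n) := fun j => by
    simpa [G, Nat.succ_iterate] using eq_sum_weightProd_of_eq_add_mul (φ := Nat.succ)
      (mapsTo_univ _ univ) (fun j _ => hf j) n (mem_univ j)
  have hG : Tendsto G atTop (𝓝 0) := by
    rw [← Finset.sum_const_zero (s := Finset.range n)]
    exact tendsto_finsetSum _ fun i _ => isBoundedUnder_le_mul_tendsto_zero
      (isBoundedUnder_of ⟨C ^ i, fun j => norm_weightProd_le_pow hC i j⟩)
      ((tendsto_add_atTop_iff_nat i).2 hg)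
  refine tendsto_zero_iff_norm_tendsto_zero.2 (tendsto_zero_of_add_le_mul_add hn
    one_half_pos.le one_half_lt_one (fun j => norm_nonneg _)
    (tendsto_zero_iff_norm_tendsto_zero.1 hG) ?_)
  filter_upwards [hw] with j hj
  have hle : 2 * ‖f (j + n)‖ ≤ ‖f j‖ + ‖G j‖ :=
    calc 2 * ‖f (j + n)‖ ≤ ‖weightProd Nat.succ w n j * f (j + n)‖ := by rw [norm_mul]; gcongr
      _ = ‖f j - G j‖ := by rw [hiter j, add_sub_cancel_left]
      _ ≤ ‖f j‖ + ‖G j‖ := norm_sub_le _ _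
  linarith [norm_nonneg (G j)]

theorem existsUnique_eq_add_mul (g w : ℕ → ℂ) (N : ℕ) (hw : ∀ j ≥ N, w j ≠ 0) (c : ℂ) :
    ∃! f : ℕ → ℂ, f N = c ∧ ∀ j, f j = g j + w j * f (j + 1) := by
  refine existsUnique_of_exists_of_unique ?_ fun f₁ f₂ ⟨h₁N, h₁⟩ ⟨h₂N, h₂⟩ => funext fun j => ?_
  · induction N generalizing w g with
    | zero =>
      refine ⟨fun j => Nat.rec c (fun i y => (y - g i) / w i) j, rfl, fun j => ?_⟩
      rw [mul_div_cancel₀ _ (hw j j.zero_le), add_sub_cancel]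
    | succ N ih =>
      obtain ⟨f, hf, hrec⟩ := ih (fun j => g (j + 1)) (fun j => w (j + 1))
        fun j hj => hw _ (by omega)
      refine ⟨fun j => Nat.casesOn j (g 0 + w 0 * f 0) f, hf, ?_⟩
      rintro (_ | j)
      exacts [rfl, hrec j]
  · rcases le_total N j with h | h
    · induction j, h using Nat.le_induction with
      | base => rw [h₁N, h₂N]
      | succ j hj ih =>
        rw [h₁, h₂] at ih
        exact mul_left_cancel₀ (hw j hj) (add_left_cancel ih)
    · induction h using Nat.decreasingInduction with
      | self => rw [h₁N, h₂N]
      | of_succ j _ ih => rw [h₁, h₂, ih]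

theorem tendsto_cofinite_prod {ι β γ : Type*} [Finite ι] {a : ι × β → γ} {l : Filter γ}
    (h : ∀ i, Tendsto (fun j => a (i, j)) cofinite l) : Tendsto a cofinite l := fun _ hs =>
  (finite_iUnion fun i => (h i hs).image (Prod.mk i)).subset fun p hp =>
    mem_iUnion.2 ⟨p.1, p.2, hp, rfl⟩

end Sequences

section Gluing

variable {X : Type*} [TopologicalSpace X]

theorem exists_continuousMap_eqOn_of_union_eq_univ {A B : Set X} (hA : IsClosed A)
    (hB : IsClosed B) (hAB : A ∪ B = univ) {f : X → ℂ} (hf : ContinuousOn f A)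
    (hf0 : ∀ x ∈ A ∩ B, f x = 0) : ∃ h : C(X, ℂ), EqOn h f A ∧ ∀ x ∈ B, h x = 0 := by
  have hA' : EqOn (A.indicator f) f A := eqOn_indicator
  have hB' : ∀ x ∈ B, A.indicator f x = 0 := fun x hx =>
    indicator_apply_eq_zero.2 fun hxA => hf0 x ⟨hxA, hx⟩
  refine ⟨⟨A.indicator f, ?_⟩, hA', hB'⟩
  rw [← continuousOn_univ, ← hAB]
  exact (hf.congr hA').union_of_isClosed (continuousOn_const.congr hB') hA hB

theorem exists_continuousMap_of_tendsto_cofinite [T1Space X] {ι : Type*} {p : ι → X}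
    (hp : Injective p) (hpo : ∀ i, IsOpen {p i}) {a : ι → ℂ} (ha : Tendsto a cofinite (𝓝 0)) :
    ∃ f : C(X, ℂ), (∀ i, f (p i) = a i) ∧ ∀ x ∉ range p, f x = 0 := by
  refine ⟨⟨extend p a 0, continuous_iff_continuousAt.2 fun x => ?_⟩, hp.extend_apply a 0,
    fun x hx => extend_apply' _ _ _ hx⟩
  by_cases hx : x ∈ range p
  · obtain ⟨i, rfl⟩ := hx
    rw [ContinuousAt, (isOpen_singleton_iff_nhds_eq_pure _).1 (hpo i)]
    exact tendsto_pure_nhds _ _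
  · rw [ContinuousAt, extend_apply' _ _ _ hx]
    intro s hs
    have hfin : (p '' (a ⁻¹' s)ᶜ).Finite := (ha hs).image p
    refine mem_map.2 (mem_of_superset (hfin.isClosed.isOpen_compl.mem_nhds fun ⟨i, _, hi⟩ =>
      hx ⟨i, hi⟩) fun y hy => ?_)
    by_cases hy' : y ∈ range p
    · obtain ⟨i, rfl⟩ := hy'
      rw [Set.mem_preimage, hp.extend_apply]
      exact not_not.1 fun h => hy ⟨i, h, rfl⟩
    · rw [Set.mem_preimage, extend_apply' _ _ y hy']
      exact mem_of_mem_nhds hs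

end Gluing

section Solutions

variable {X : Type*} [TopologicalSpace X] [CompactSpace X]

theorem IsHyperbolicSplitting.eq_zero_of_eq_mul {φ : C(X, X)} {v : C(X, ℂ)} {M₁ M₂ : Set X}
    (h : IsHyperbolicSplitting φ v M₁ M₂) (hφ : Injective φ) {N : ℕ}
    (hN : ∀ x ∈ φ^[N] '' M₂, v x ≠ 0) {f : C(X, ℂ)} (hfL : ∀ x ∈ setL φ, f x = 0)
    (hf : ∀ x, f x = v x * f (φ x)) (hfN : ∀ p ∈ M₂ \ φ '' M₂, f (φ^[N] p) = 0) : f = 0 := by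
  ext x
  by_cases hxL : x ∈ setL φ
  · exact hfL x hxL
  rcases h.mem_or_mem hxL with hx₁ | hx₂
  · exact h.decay.eq_zero_of_eq_mul h.mapsTo_left h.isClosed_left.isCompact
      f.continuous.continuousOn (fun x _ => hf x) hx₁
  · have hxt : x ∈ M₂ \ iterInter φ M₂ := ⟨hx₂, fun hx' => hxL (iterInter_subset_setL hx')⟩
    rw [diff_iterInter_eq_biUnion_trajectory hφ h.mapsTo_right] at hxt
    obtain ⟨p, hp, j, rfl⟩ := mem_iUnion₂.1 hxt
    have huniq := (existsUnique_eq_add_mul 0 (fun j => v (φ^[j] p)) N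
      (fun j hj => hN _ (iterate_mem_image_iterate h.mapsTo_right hp.1 hj)) 0).unique
      (y₁ := fun j => f (φ^[j] p)) (y₂ := 0)
      ⟨hfN p hp, fun j => by rw [hf (φ^[j] p), iterate_succ_apply', Pi.zero_apply, zero_add]⟩
      ⟨rfl, fun j => by simp⟩
    exact congrFun huniq j

variable [T2Space X]

theorem exists_eq_add_mul_of_uniformDecay {φ : C(X, X)} {v : C(X, ℂ)} {A : Set X}
    (hA : MapsTo φ A A) (hAc : IsClosed A) (h : UniformDecay φ v A) (g : C(X, ℂ)) :
    ∃ f : C(X, ℂ), ∀ x ∈ A, f x = g x + v x * f (φ x) := by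
  have := isCompact_iff_compactSpace.1 hAc.isCompact
  have hrad : spectralRadius ℂ (weightedCompOn φ v A hA) < ‖(1 : ℂ)‖₊ := by
    rw [← enorm_eq_nnnorm, ← ofReal_norm,
      spectralRadius_weightedCompOn_lt_iff one_ne_zero hA hAc, inv_one, one_smul]
    exact h
  obtain ⟨u, hu⟩ := spectrum.mem_resolventSet_iff.1
    (spectrum.mem_resolventSet_of_spectralRadius_lt hrad)
  obtain ⟨f, hf⟩ := ContinuousMap.exists_restrict_eq hAc
    ((↑u⁻¹ : C(A, ℂ) →L[ℂ] C(A, ℂ)) (g.restrict A))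
  have huf : (u : C(A, ℂ) →L[ℂ] C(A, ℂ)) (f.restrict A) = g.restrict A := by
    rw [hf, ← mul_apply_eq_comp, Units.mul_inv, one_apply_eq_self]
  rw [hu, map_one] at huf
  exact ⟨f, fun x hx => sub_eq_iff_eq_add.1 (DFunLike.congr_fun huf ⟨x, hx⟩)⟩

theorem tendsto_iterate_zero {φ : X → X} (hφ : Continuous φ) {A : Set X} (hA : MapsTo φ A A)
    (hAc : IsClosed A) {g : X → ℂ} (hg : Continuous g) (hg0 : ∀ x ∈ iterInter φ A, g x = 0)
    {p : X} (hp : p ∈ A) : Tendsto (fun j : ℕ => g (φ^[j] p)) atTop (𝓝 0) := by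
  refine tendsto_zero_iff_norm_tendsto_zero.2 (tendsto_order.2
    ⟨fun ε hε => Eventually.of_forall fun j => hε.trans_le (norm_nonneg _), fun ε hε => ?_⟩)
  obtain ⟨N, hN⟩ := exists_image_iterate_subset hφ hAc hA
    (isOpen_lt hg.norm continuous_const) (U := {x | ‖g x‖ < ε}) fun x hx => by
      simpa [hg0 x hx] using hε
  exact eventually_atTop.2 ⟨N, fun j hj => hN (iterate_mem_image_iterate hA hp hj)⟩

namespace IsHyperbolicSplitting

variable {φ : C(X, X)} {v : C(X, ℂ)} {M₁ M₂ : Set X}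

theorem isOpen_singleton_and_notMem_setL (h : IsHyperbolicSplitting φ v M₁ M₂) {x : X}
    (hx : x ∈ M₂ \ iterInter φ M₂) : IsOpen {x} ∧ x ∉ setL φ := by
  obtain ⟨n, hn⟩ : ∃ n : ℕ, x ∉ φ^[n] '' M₂ := by simpa [iterInter] using hx.2
  set V := (M₁ ∪ φ^[n] '' M₂)ᶜ
  have hV : IsOpen V := (h.isClosed_left.union
    (h.isClosed_right.isCompact.image (φ.continuous.iterate n)).isClosed).isOpen_compl
  have hxV : x ∈ V := fun hx' => hx'.elim (fun hx₁ => h.disjoint.notMem_of_mem_left hx₁ hx.1) hn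
  have hfin : (V ∩ (setL φ)ᶜ).Finite := (finite_diff_image_iterate h.finite_diff n).subset
    fun y ⟨hyV, hyL⟩ => ⟨(h.mem_or_mem hyL).resolve_left fun hy₁ => hyV (Or.inl hy₁),
      fun hyn => hyV (Or.inr hyn)⟩
  have hxM : x ∈ closure (setL φ)ᶜ := by
    rw [← setM_eq_closure, ← h.union_eq]
    exact Or.inr hx.1
  have hxL : x ∈ V ∩ (setL φ)ᶜ := hfin.isClosed.closure_eq ▸ hV.inter_closure ⟨hxV, hxM⟩
  have hopen : IsOpen (V ∩ (setL φ)ᶜ) := hV.inter (isClosed_setL φ.continuous).isOpen_compl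
  exact ⟨isOpen_singleton_of_finite_mem_nhds x (hopen.mem_nhds hxL) hfin, hxL.2⟩

theorem exists_forall_two_le (h : IsHyperbolicSplitting φ v M₁ M₂) : ∃ n N : ℕ,
    ∀ x ∈ φ^[N] '' M₂, v x ≠ 0 ∧ 2 ≤ ‖weightProd φ v n x‖ := by
  obtain ⟨n, hn⟩ := (h.growth 3).exists
  obtain ⟨N, hN⟩ := exists_image_iterate_subset φ.continuous h.isClosed_right h.mapsTo_right
    ((isOpen_ne_fun v.continuous continuous_const).inter (isOpen_lt continuous_const
      (continuous_weightProd φ.continuous v.continuous n).norm))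
    fun x hx => ⟨h.growth.ne_zero hx, show (2 : ℝ) < _ by linarith [hn x hx]⟩
  exact ⟨n, N, fun x hx => ⟨(hN hx).1, (hN hx).2.le⟩⟩

theorem exists_solution_left (h : IsHyperbolicSplitting φ v M₁ M₂) {g : C(X, ℂ)}
    (hg : ∀ x ∈ setL φ, g x = 0) : ∃ f : C(X, ℂ), (∀ x ∈ setL φ ∪ M₂, f x = 0) ∧
      ∀ x ∈ M₁, f x = g x + v x * f (φ x) := by
  obtain ⟨f₁, hf₁⟩ := exists_eq_add_mul_of_uniformDecay h.mapsTo_left h.isClosed_left h.decay g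
  have hf₁L : ∀ x ∈ M₁ ∩ setL φ, f₁ x = 0 := fun x hx =>
    (h.decay.mono inter_subset_left).eq_zero_of_eq_mul (h.mapsTo_left.inter_inter (mapsTo_setL φ))
      (h.isClosed_left.inter (isClosed_setL φ.continuous)).isCompact f₁.continuous.continuousOn
      (fun y hy => by rw [hf₁ y hy.1, hg y hy.2, zero_add]) hx
  have hcover : M₁ ∪ (setL φ ∪ M₂) = univ := eq_univ_of_forall fun x => by
    by_cases hx : x ∈ setL φ
    · exact Or.inr (Or.inl hx)
    · exact (h.mem_or_mem hx).imp_right Or.inr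
  obtain ⟨f, hf, hf0⟩ := exists_continuousMap_eqOn_of_union_eq_univ h.isClosed_left
    ((isClosed_setL φ.continuous).union h.isClosed_right) hcover
    f₁.continuous.continuousOn fun x ⟨hx₁, hx⟩ => hx.elim (fun hxL => hf₁L x ⟨hx₁, hxL⟩)
      fun hx₂ => absurd hx₂ (h.disjoint.notMem_of_mem_left hx₁)
  exact ⟨f, hf0, fun x hx => by rw [hf hx, hf₁ x hx, hf (h.mapsTo_left hx)]⟩

theorem exists_solution_trajectory (h : IsHyperbolicSplitting φ v M₁ M₂) {n N : ℕ}
    (hN : ∀ x ∈ φ^[N] '' M₂, v x ≠ 0 ∧ 2 ≤ ‖weightProd φ v n x‖) {g : C(X, ℂ)}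
    (hg : ∀ x ∈ setL φ, g x = 0) {p : X} (hp : p ∈ M₂) (c : ℂ) :
    ∃ F : ℕ → ℂ, F N = c ∧ (∀ j, F j = g (φ^[j] p) + v (φ^[j] p) * F (j + 1)) ∧
      Tendsto F atTop (𝓝 0) := by
  have hpN : ∀ j ≥ N, φ^[j] p ∈ φ^[N] '' M₂ := fun j hj =>
    iterate_mem_image_iterate h.mapsTo_right hp hj
  obtain ⟨F, ⟨hFN, hF⟩, -⟩ := existsUnique_eq_add_mul (fun j => g (φ^[j] p))
    (fun j => v (φ^[j] p)) N (fun j hj => (hN _ (hpN j hj)).1) c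
  refine ⟨F, hFN, hF, tendsto_zero_of_eq_add_mul (n := n) (fun j => v.norm_coe_le_norm _)
    (eventually_atTop.2 ⟨N, fun j hj => ?_⟩) (tendsto_iterate_zero φ.continuous h.mapsTo_right
      h.isClosed_right g.continuous (fun x hx => hg x (iterInter_subset_setL hx)) hp) hF⟩
  rw [weightProd_trajectory]
  exact (hN _ (hpN j hj)).2

theorem exists_solution_right (h : IsHyperbolicSplitting φ v M₁ M₂) (hφ : Injective φ) {n N : ℕ}
    (hN : ∀ x ∈ φ^[N] '' M₂, v x ≠ 0 ∧ 2 ≤ ‖weightProd φ v n x‖) {g : C(X, ℂ)}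
    (hg : ∀ x ∈ setL φ, g x = 0) (c : ↥(M₂ \ φ '' M₂) → ℂ) :
    ∃ f : C(X, ℂ), (∀ x ∈ setL φ ∪ M₁, f x = 0) ∧ (∀ x ∈ M₂, f x = g x + v x * f (φ x)) ∧
      ∀ p : ↥(M₂ \ φ '' M₂), f (φ^[N] p) = c p := by
  have hmem : ∀ (p : ↥(M₂ \ φ '' M₂)) (j : ℕ), φ^[j] (p : X) ∈ M₂ \ iterInter φ M₂ :=
    fun p j => diff_iterInter_eq_biUnion_trajectory hφ h.mapsTo_right ▸
      mem_biUnion p.2 (mem_range_self j)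
  choose F hFN hFrec hF0 using fun p : ↥(M₂ \ φ '' M₂) =>
    h.exists_solution_trajectory hN hg p.2.1 (c p)
  have := h.finite_diff.to_subtype
  obtain ⟨f, hf, hf0⟩ := exists_continuousMap_of_tendsto_cofinite
    (p := fun i : ↥(M₂ \ φ '' M₂) × ℕ => φ^[i.2] i.1) (a := fun i => F i.1 i.2)
    (fun i j hij => by
      obtain ⟨h₁, h₂⟩ := iterate_inj_of_notMem_image hφ h.mapsTo_right i.1.2 j.1.2 hij
      exact Prod.ext (Subtype.ext h₁) h₂)
    (fun i => (h.isOpen_singleton_and_notMem_setL (hmem i.1 i.2)).1)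
    (tendsto_cofinite_prod fun p => by rw [Nat.cofinite_eq_atTop]; exact hF0 p)
  have hf0L : ∀ x ∈ setL φ, f x = 0 := fun x hx => hf0 x (by
    rintro ⟨i, rfl⟩
    exact (h.isOpen_singleton_and_notMem_setL (hmem i.1 i.2)).2 hx)
  refine ⟨f, fun x hx => hx.elim (hf0L x) fun hx₁ => hf0 x ?_, fun x hx => ?_, fun p => ?_⟩
  · rintro ⟨i, rfl⟩
    exact h.disjoint.notMem_of_mem_left hx₁ (hmem i.1 i.2).1
  · by_cases hxL : x ∈ setL φ
    · rw [hf0L x hxL, hf0L _ (mapsTo_setL φ hxL), hg x hxL, mul_zero, add_zero]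
    · have hxt : x ∈ M₂ \ iterInter φ M₂ := ⟨hx, fun hx' => hxL (iterInter_subset_setL hx')⟩
      rw [diff_iterInter_eq_biUnion_trajectory hφ h.mapsTo_right] at hxt
      obtain ⟨p, hp, j, rfl⟩ := mem_iUnion₂.1 hxt
      have hsucc := hf (⟨p, hp⟩, j + 1)
      simp only [iterate_succ_apply'] at hsucc
      exact (hf (⟨p, hp⟩, j)).trans ((hFrec ⟨p, hp⟩ j).trans (by rw [hsucc]))
  · exact (hf (p, N)).trans (hFN p)

theorem existsUnique_solution (h : IsHyperbolicSplitting φ v M₁ M₂) (hφ : Injective φ) :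
    ∃ N : ℕ, ∀ g : C(X, ℂ), (∀ x ∈ setL φ, g x = 0) → ∀ c : ↥(M₂ \ φ '' M₂) → ℂ,
      ∃! f : C(X, ℂ), (∀ x ∈ setL φ, f x = 0) ∧ (∀ x, f x = g x + v x * f (φ x)) ∧
        ∀ p : ↥(M₂ \ φ '' M₂), f (φ^[N] p) = c p := by
  obtain ⟨n, N, hN⟩ := h.exists_forall_two_le
  refine ⟨N, fun g hg c => existsUnique_of_exists_of_unique ?_ ?_⟩
  · obtain ⟨f₁, hf₁0, hf₁⟩ := h.exists_solution_left hg
    obtain ⟨f₂, hf₂0, hf₂, hf₂c⟩ := h.exists_solution_right hφ hN hg c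
    refine ⟨f₁ + f₂, fun x hx => ?_, fun x => ?_, fun p => ?_⟩
    · simp [hf₁0 x (Or.inl hx), hf₂0 x (Or.inl hx)]
    · by_cases hxL : x ∈ setL φ
      · simp [hf₁0 x (Or.inl hxL), hf₂0 x (Or.inl hxL), hf₁0 _ (Or.inl (mapsTo_setL φ hxL)),
          hf₂0 _ (Or.inl (mapsTo_setL φ hxL)), hg x hxL]
      rcases h.mem_or_mem hxL with hx | hx
      · simp [hf₂0 x (Or.inr hx), hf₂0 _ (Or.inr (h.mapsTo_left hx)), hf₁ x hx]
      · simp [hf₁0 x (Or.inr hx), hf₁0 _ (Or.inr (h.mapsTo_right hx)), hf₂ x hx]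
    · simp [hf₁0 _ (Or.inr (h.mapsTo_right.iterate N p.2.1)), hf₂c]
  · rintro f₁ f₂ ⟨hf₁L, hf₁, hf₁c⟩ ⟨hf₂L, hf₂, hf₂c⟩
    refine sub_eq_zero.1 (h.eq_zero_of_eq_mul hφ (fun x hx => (hN x hx).1) (fun x hx => ?_)
      (fun x => ?_) fun p hp => ?_)
    · simp [hf₁L x hx, hf₂L x hx]
    · simp only [ContinuousMap.sub_apply, hf₁ x, hf₂ x]
      ring
    · simp [hf₁c ⟨p, hp⟩, hf₂c ⟨p, hp⟩]

end IsHyperbolicSplitting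

end Solutions

section Extension

variable {R E F G : Type*} [Ring R] [AddCommGroup E] [Module R E] [AddCommGroup F] [Module R F]
  [AddCommGroup G] [Module R G] {S : E →ₗ[R] E} {S' : F →ₗ[R] F} {r : E →ₗ[R] F} {e : E →ₗ[R] G}

theorem nonempty_ker_equiv_prod (hr : Surjective r) (hcomm : r ∘ₗ S = S' ∘ₗ r)
    (h : ∀ g c, r g = 0 → ∃! f, r f = 0 ∧ S f = g ∧ e f = c) :
    Nonempty (LinearMap.ker S ≃ₗ[R] LinearMap.ker S' × G) := by
  have hcomm' : ∀ x, r (S x) = S' (r x) := LinearMap.congr_fun hcomm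
  have hmaps : ∀ x ∈ LinearMap.ker S, r x ∈ LinearMap.ker S' := fun x hx => by
    rw [LinearMap.mem_ker, ← hcomm', LinearMap.mem_ker.1 hx, map_zero]
  refine ⟨LinearEquiv.ofBijective ((r.restrict hmaps).prod (e ∘ₗ (LinearMap.ker S).subtype))
    ((bijective_iff_existsUnique _).2 ?_)⟩
  rintro ⟨⟨y, hy⟩, c⟩
  obtain ⟨x, rfl⟩ := hr y
  obtain ⟨f, ⟨hrf, hSf, hef⟩, huniq⟩ := h (S x) (e x - c) (by rw [hcomm', LinearMap.mem_ker.1 hy])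
  refine ⟨⟨x - f, by rw [LinearMap.mem_ker, map_sub, hSf, sub_self]⟩,
    Prod.ext (Subtype.ext ?_) ?_, ?_⟩
  · simp [hrf]
  · simp [hef]
  · rintro ⟨z, hz⟩ hzc
    obtain ⟨hrz, hez⟩ := Prod.ext_iff.1 hzc
    have hrz : r z = r x := congrArg Subtype.val hrz
    have hez : e z = c := hez
    exact Subtype.ext (eq_sub_of_add_eq' (add_eq_of_eq_sub (huniq (x - z)
      ⟨by rw [map_sub, hrz, sub_self], by rw [map_sub, LinearMap.mem_ker.1 hz, sub_zero],
        by rw [map_sub, hez]⟩).symm))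

theorem range_eq_preimage_range (hr : Surjective r) (hcomm : r ∘ₗ S = S' ∘ₗ r)
    (h : ∀ g, r g = 0 → ∃ f, S f = g) : range S = r ⁻¹' range S' := by
  have hcomm' : ∀ x, r (S x) = S' (r x) := LinearMap.congr_fun hcomm
  ext g
  constructor
  · rintro ⟨f, rfl⟩
    exact ⟨r f, (hcomm' f).symm⟩
  · rintro ⟨y, hy⟩
    obtain ⟨f, rfl⟩ := hr y
    obtain ⟨f', hf'⟩ := h (g - S f) (by rw [map_sub, hcomm', hy, sub_self])
    exact ⟨f + f', by rw [map_add, hf', add_sub_cancel]⟩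

end Extension

section UpperSemiFredholm

variable {E F G : Type*} [NormedAddCommGroup E] [NormedSpace ℂ E]
  [NormedAddCommGroup F] [NormedSpace ℂ F] [AddCommGroup G] [Module ℂ G]
  [FiniteDimensional ℂ G] {S : E →L[ℂ] E} {S' : F →L[ℂ] F} {r : E →L[ℂ] F} {e : E →ₗ[ℂ] G}

theorem finrank_ker_eq_add_of_intertwining
    [FiniteDimensional ℂ (LinearMap.ker (S' : F →ₗ[ℂ] F))]
    (hr : Surjective r) (hcomm : r ∘L S = S' ∘L r)
    (h : ∀ g c, r g = 0 → ∃! f, r f = 0 ∧ S f = g ∧ e f = c) :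
    Module.finrank ℂ (LinearMap.ker (S : E →ₗ[ℂ] E)) =
      Module.finrank ℂ (LinearMap.ker (S' : F →ₗ[ℂ] F)) + Module.finrank ℂ G := by
  obtain ⟨eqv⟩ := nonempty_ker_equiv_prod (S := (S : E →ₗ[ℂ] E)) (S' := (S' : F →ₗ[ℂ] F))
    (r := (r : E →ₗ[ℂ] F)) (e := e) hr (congrArg ContinuousLinearMap.toLinearMap hcomm) h
  rw [eqv.finrank_eq, Module.finrank_prod]

variable [CompleteSpace E] [CompleteSpace F]

theorem isUpperSemiFredholm_iff_of_intertwining (hr : Surjective r) (hcomm : r ∘L S = S' ∘L r)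
    (h : ∀ g c, r g = 0 → ∃! f, r f = 0 ∧ S f = g ∧ e f = c) :
    IsUpperSemiFredholm S ↔ IsUpperSemiFredholm S' := by
  have hcomm' := congrArg ContinuousLinearMap.toLinearMap hcomm
  obtain ⟨eqv⟩ := nonempty_ker_equiv_prod (S := (S : E →ₗ[ℂ] E)) (S' := (S' : F →ₗ[ℂ] F))
    (r := (r : E →ₗ[ℂ] F)) (e := e) hr hcomm' h
  have hrange : range S = r ⁻¹' range S' := range_eq_preimage_range (S := (S : E →ₗ[ℂ] E))
    (S' := (S' : F →ₗ[ℂ] F)) (r := (r : E →ₗ[ℂ] F)) hr hcomm' fun g hg =>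
      let ⟨f, ⟨_, hf, _⟩, _⟩ := h g 0 hg
      ⟨f, hf⟩
  refine and_congr ⟨fun hfin => ?_, fun hfin => ?_⟩ ?_
  · exact Module.Finite.of_surjective ((LinearMap.fst ℂ _ _).comp eqv.toLinearMap)
      (Prod.fst_surjective.comp eqv.surjective)
  · exact Module.Finite.equiv eqv.symm
  · rw [hrange]
    exact (r.isQuotientMap hr).isClosed_preimage

end UpperSemiFredholm

/-- Restriction of continuous functions to a subset, as a continuous linear map. -/
noncomputable def restrictCLM {X : Type*} [TopologicalSpace X] (A : Set X) :
    C(X, ℂ) →L[ℂ] C(A, ℂ) where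
  toFun f := f.restrict A
  map_add' _ _ := rfl
  map_smul' _ _ := rfl
  cont := ContinuousMap.continuous_restrict A

theorem restrictCLM_eq_zero_iff {X : Type*} [TopologicalSpace X] {A : Set X} {f : C(X, ℂ)} :
    restrictCLM A f = 0 ↔ ∀ x ∈ A, f x = 0 :=
  ⟨fun h x hx => DFunLike.congr_fun h ⟨x, hx⟩, fun h => ContinuousMap.ext fun x => h x x.2⟩

namespace IsHyperbolicSplitting

variable {X : Type*} [TopologicalSpace X] [CompactSpace X] [T2Space X] {φ : C(X, X)} {v : C(X, ℂ)}
  {M₁ M₂ : Set X}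

theorem existsUnique_restrictCLM (h : IsHyperbolicSplitting φ v M₁ M₂) (hφ : Injective φ) :
    ∃ e : C(X, ℂ) →ₗ[ℂ] (↥(M₂ \ φ '' M₂) → ℂ), ∀ g c, restrictCLM (setL φ) g = 0 →
      ∃! f, restrictCLM (setL φ) f = 0 ∧
        (ContinuousLinearMap.id ℂ C(X, ℂ) - weightedComp φ v) f = g ∧ e f = c := by
  obtain ⟨N, hN⟩ := h.existsUnique_solution hφ
  refine ⟨⟨⟨fun f p => f (φ^[N] p), fun _ _ => rfl⟩, fun _ _ => rfl⟩, fun g c hg => ?_⟩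
  refine (existsUnique_congr fun f => and_congr restrictCLM_eq_zero_iff (and_congr ?_ ?_)).2
    (hN g (restrictCLM_eq_zero_iff.1 hg) c)
  · rw [ContinuousMap.ext_iff]
    exact forall_congr' fun x => sub_eq_iff_eq_add
  · exact funext_iff

theorem isUpperSemiFredholm_iff (h : IsHyperbolicSplitting φ v M₁ M₂) (hφ : Injective φ) :
    IsUpperSemiFredholm (ContinuousLinearMap.id ℂ C(X, ℂ) - weightedComp φ v) ↔
      IsUpperSemiFredholm (ContinuousLinearMap.id ℂ C(setL φ, ℂ) -
        weightedCompOn φ v (setL φ) (mapsTo_setL φ)) := by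
  have hL := isClosed_setL φ.continuous
  have := isCompact_iff_compactSpace.1 hL.isCompact
  have := h.finite_diff.to_subtype
  obtain ⟨e, he⟩ := h.existsUnique_restrictCLM hφ
  exact isUpperSemiFredholm_iff_of_intertwining
    (fun f => ContinuousMap.exists_restrict_eq hL f) rfl he

theorem finrank_ker_eq (h : IsHyperbolicSplitting φ v M₁ M₂) (hφ : Injective φ)
    [FiniteDimensional ℂ (LinearMap.ker ((ContinuousLinearMap.id ℂ C(setL φ, ℂ) -
      weightedCompOn φ v (setL φ) (mapsTo_setL φ) : C(setL φ, ℂ) →L[ℂ] C(setL φ, ℂ)) :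
        C(setL φ, ℂ) →ₗ[ℂ] C(setL φ, ℂ)))] :
    Module.finrank ℂ (LinearMap.ker ((ContinuousLinearMap.id ℂ C(X, ℂ) - weightedComp φ v :
        C(X, ℂ) →L[ℂ] C(X, ℂ)) : C(X, ℂ) →ₗ[ℂ] C(X, ℂ))) =
      Module.finrank ℂ (LinearMap.ker ((ContinuousLinearMap.id ℂ C(setL φ, ℂ) -
        weightedCompOn φ v (setL φ) (mapsTo_setL φ) : C(setL φ, ℂ) →L[ℂ] C(setL φ, ℂ)) :
          C(setL φ, ℂ) →ₗ[ℂ] C(setL φ, ℂ))) + (M₂ \ φ '' M₂).ncard := by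
  have hL := isClosed_setL φ.continuous
  have := isCompact_iff_compactSpace.1 hL.isCompact
  have := h.finite_diff.fintype
  obtain ⟨e, he⟩ := h.existsUnique_restrictCLM hφ
  rw [← Nat.card_coe_set_eq, Nat.card_eq_fintype_card, ← Module.finrank_fintype_fun_eq_card ℂ]
  exact finrank_ker_eq_add_of_intertwining (r := restrictCLM (setL φ))
    (S' := ContinuousLinearMap.id ℂ C(setL φ, ℂ) - weightedCompOn φ v (setL φ) (mapsTo_setL φ))
    (fun f => ContinuousMap.exists_restrict_eq hL f) rfl he

end IsHyperbolicSplitting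

section BoundedBelow

theorem exists_finset_forall_eq_zero {ι R V W : Type*} [Ring R] [AddCommGroup V] [Module R V]
    [AddCommGroup W] [Module R W] [IsArtinian R V] {e : ι → V →ₗ[R] W}
    (he : ∀ f, (∀ i, e i f = 0) → f = 0) : ∃ s : Finset ι, ∀ f, (∀ i ∈ s, e i f = 0) → f = 0 := by
  obtain ⟨s, hs⟩ := Finset.exists_inf_le fun i => LinearMap.ker (e i)
  exact ⟨s, fun f hf => he f fun i => hs i (Submodule.mem_finsetInf.2 hf)⟩

theorem exists_norm_le_mul_norm_apply {𝕜 E F G : Type*} [NontriviallyNormedField 𝕜]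
    [CompleteSpace 𝕜] [NormedAddCommGroup E] [NormedSpace 𝕜 E] [CompleteSpace E]
    [NormedAddCommGroup F] [NormedSpace 𝕜 F] [CompleteSpace F] [NormedAddCommGroup G]
    [NormedSpace 𝕜 G] {S : E →L[𝕜] F} [FiniteDimensional 𝕜 (LinearMap.ker (S : E →ₗ[𝕜] F))]
    (hS : IsClosed (range S)) {e : E →L[𝕜] G} (he : ∀ f, S f = 0 → e f = 0 → f = 0) :
    ∃ C : ℝ, 1 ≤ C ∧ ∀ f, e f = 0 → ‖f‖ ≤ C * ‖S f‖ := by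
  obtain ⟨K, -, hK⟩ := ((e : E →ₗ[𝕜] G).domRestrict (LinearMap.ker
    (S : E →ₗ[𝕜] F))).exists_antilipschitzWith
      (LinearMap.ker_eq_bot'.2 fun f hf => Subtype.ext (he f f.2 hf))
  have : CompleteSpace (LinearMap.range (S : E →ₗ[𝕜] F)) := hS.completeSpace_coe
  obtain ⟨C, -, hpre⟩ := (S.codRestrict (LinearMap.range (S : E →ₗ[𝕜] F))
    fun x => ⟨x, rfl⟩).exists_preimage_norm_le fun ⟨_, x, hx⟩ => ⟨x, Subtype.ext hx⟩
  refine ⟨max 1 ((K * ‖e‖ + 1) * C), le_max_left _ _, fun f hf => ?_⟩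
  obtain ⟨r, hr, hrn⟩ := hpre ⟨S f, f, rfl⟩
  have hr : S r = S f := congrArg Subtype.val hr
  have hrn : ‖r‖ ≤ C * ‖S f‖ := hrn
  have hker : ‖f - r‖ ≤ K * ‖e (f - r)‖ := by
    simpa [dist_eq_norm] using hK.le_mul_dist
      ⟨f - r, by change S (f - r) = 0; rw [map_sub, hr, sub_self]⟩ 0
  calc ‖f‖ ≤ ‖f - r‖ + ‖r‖ := by simpa using norm_add_le (f - r) r
    _ ≤ K * (‖e‖ * ‖r‖) + ‖r‖ := by
      gcongr
      refine hker.trans ?_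
      rw [map_sub, hf, zero_sub, norm_neg]
      gcongr
      exact e.le_opNorm r
    _ = (K * ‖e‖ + 1) * ‖r‖ := by ring
    _ ≤ (K * ‖e‖ + 1) * (C * ‖S f‖) := by gcongr
    _ = (K * ‖e‖ + 1) * C * ‖S f‖ := (mul_assoc _ _ _).symm
    _ ≤ max 1 ((K * ‖e‖ + 1) * C) * ‖S f‖ := by gcongr; exact le_max_right _ _

theorem sum_range_succ_smul_sub {M : Type*} [AddCommGroup M] (u : ℕ → M) (n : ℕ) :
    ∑ j ∈ Finset.range n, (j + 1) • (u j - u (j + 1)) = ∑ j ∈ Finset.range n, u j - n • u n := by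
  induction n with
  | zero => simp
  | succ n ih =>
    rw [Finset.sum_range_succ, ih, Finset.sum_range_succ]
    module

/- A double application of the lower bound for `1 - T`: it maps `∑ (j + 1) u j` to `∑ u j`, and
`∑ u j` to `u 0`. -/
theorem norm_sum_succ_smul_le {E : Type*} [SeminormedAddCommGroup E] {T : E →+ E}
    {V : AddSubmonoid E} {C : ℝ} (hC : 0 ≤ C) (hT : ∀ f ∈ V, ‖f‖ ≤ C * ‖f - T f‖) {u : ℕ → E}
    (hu : ∀ j, T (u j) = u (j + 1)) (huV : ∀ j, u j ∈ V) {n : ℕ} (hn : u n = 0) :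
    ‖∑ j ∈ Finset.range n, (j + 1) • u j‖ ≤ C * (C * ‖u 0‖) := by
  have hsum : ∑ j ∈ Finset.range n, u j - T (∑ j ∈ Finset.range n, u j) = u 0 := by
    rw [map_sum, ← Finset.sum_sub_distrib, Finset.sum_congr rfl fun j _ => by rw [hu j],
      Finset.sum_range_sub', hn, sub_zero]
  have hsum' : ∑ j ∈ Finset.range n, (j + 1) • u j - T (∑ j ∈ Finset.range n, (j + 1) • u j) =
      ∑ j ∈ Finset.range n, u j := by
    rw [map_sum, ← Finset.sum_sub_distrib,
      Finset.sum_congr rfl fun j _ => by rw [map_nsmul, hu j, ← smul_sub],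
      sum_range_succ_smul_sub, hn, smul_zero, sub_zero]
  calc ‖∑ j ∈ Finset.range n, (j + 1) • u j‖
      ≤ C * ‖∑ j ∈ Finset.range n, u j‖ :=
        (hT _ (sum_mem fun j _ => V.nsmul_mem (huV j) _)).trans_eq (by rw [hsum'])
    _ ≤ C * (C * ‖u 0‖) := by
        gcongr
        exact (hT _ (sum_mem fun j _ => huV j)).trans_eq (by rw [hsum])

end BoundedBelow

/-- The operator `1 - T`, where `T` is the weighted composition operator, is bounded below by `C⁻¹`
on the functions which vanish on `s`. -/
def IsBoundedBelowOff {X : Type*} [TopologicalSpace X] [CompactSpace X] (φ : C(X, X)) (v : C(X, ℂ))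
    (s : Set X) (C : ℝ) : Prop :=
  ∀ f : C(X, ℂ), EqOn f 0 s → ‖f‖ ≤ C * ‖f - weightedComp φ v f‖

section Estimate

variable {X : Type*} [TopologicalSpace X] [CompactSpace X] {φ : C(X, X)} {v : C(X, ℂ)}

theorem IsUpperSemiFredholm.exists_isBoundedBelowOff
    (h : IsUpperSemiFredholm (ContinuousLinearMap.id ℂ C(X, ℂ) - weightedComp φ v)) :
    ∃ s : Set X, s.Finite ∧ ∃ C : ℝ, 1 ≤ C ∧ IsBoundedBelowOff φ v s C := by
  have := h.1
  let S := ContinuousLinearMap.id ℂ C(X, ℂ) - weightedComp φ v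
  obtain ⟨s, hs⟩ := exists_finset_forall_eq_zero (e := fun x : X =>
    (ContinuousMap.evalCLM ℂ x : C(X, ℂ) →L[ℂ] ℂ).toLinearMap.domRestrict
      (LinearMap.ker (S : C(X, ℂ) →ₗ[ℂ] C(X, ℂ))))
    fun f hf => Subtype.ext (ContinuousMap.ext fun x => hf x)
  obtain ⟨C, hC, hb⟩ := exists_norm_le_mul_norm_apply h.2 (e := restrictCLM (s : Set X))
    fun f hf hfs => congrArg Subtype.val (hs ⟨f, hf⟩ (restrictCLM_eq_zero_iff.1 hfs))
  exact ⟨s, s.finite_toSet, C, hC, fun f hf => hb f (restrictCLM_eq_zero_iff.2 hf)⟩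

variable [T2Space X]

theorem exists_norm_le_one_eqOn_zero {B : Set X} (hB : IsClosed B) {z : X} (hz : z ∉ B) :
    ∃ h : C(X, ℂ), ‖h‖ ≤ 1 ∧ EqOn h 0 B ∧ h z = 1 := by
  obtain ⟨b, hb0, hb1, hbI⟩ := exists_continuous_zero_one_of_isClosed hB isClosed_singleton
    (disjoint_singleton_right.2 hz)
  refine ⟨⟨fun x => (b x : ℂ), by fun_prop⟩, (ContinuousMap.norm_le _ zero_le_one).2 fun x => ?_,
    fun x hx => ?_, ?_⟩
  · simpa [abs_of_nonneg (hbI x).1] using (hbI x).2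
  · simp [hb0 hx]
  · simp [hb1 (mem_singleton z)]

end Estimate

theorem injective_iterate_of_notMem_range {X : Type*} {φ : X → X} (hφ : Injective φ) {p : X}
    (hp : p ∉ range φ) : Injective fun n : ℕ => φ^[n] p := fun _ _ h =>
  have hp : p ∈ univ \ φ '' univ := ⟨mem_univ p, by rwa [image_univ]⟩
  (iterate_inj_of_notMem_image hφ (mapsTo_univ φ univ) hp hp h).2

theorem weightProd_eq_zero_of_iterate_eq {X : Type*} {φ : X → X} {v : X → ℂ} {s : Set X}
    (hφ : Injective φ) {p : X} {k i j : ℕ}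
    (hps : ∀ m : ℕ, φ^[m] p ∈ s → ∃ a ∈ Ico m k, v (φ^[a] p) = 0) {x : X} (hx : x ∈ s)
    (hj : j ≤ k + i) (hxp : φ^[j] x = φ^[k + i] p) : weightProd φ v j x = 0 := by
  obtain rfl : x = φ^[k + i - j] p := hφ.iterate j (by
    rw [hxp, ← iterate_add_apply, Nat.add_sub_cancel' hj])
  obtain ⟨a, ⟨ha, hak⟩, hva⟩ := hps _ hx
  refine Finset.prod_eq_zero (i := a - (k + i - j)) (Finset.mem_range.2 (by omega)) ?_
  rw [← iterate_add_apply, Nat.sub_add_cancel ha, hva]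

section Decay

variable {X : Type*} [TopologicalSpace X] [CompactSpace X] [T2Space X] {φ : C(X, X)} {v : C(X, ℂ)}
  {s : Set X} {C : ℝ}

theorem exists_norm_le_one_apply_iterate_eq_zero (hφ : Injective φ) (hs : s.Finite) {p : X}
    (hp : p ∉ range φ) (n : ℕ) : ∃ h : C(X, ℂ), ‖h‖ ≤ 1 ∧ h (φ^[n] p) = 1 ∧
      (∀ j > n, ∀ x, h (φ^[j] x) = 0) ∧
      ∀ j, ∀ x ∈ s, φ^[j] x ≠ φ^[n] p → h (φ^[j] x) = 0 := by
  set B : Set X := φ^[n + 1] '' univ ∪ (⋃ j ∈ Iic n, φ^[j] '' s) \ {φ^[n] p}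
  have hB : IsClosed B := (isCompact_univ.image (φ.continuous.iterate _)).isClosed.union
    (((finite_Iic n).biUnion fun j _ => hs.image _).subset sdiff_subset).isClosed
  have hpB : φ^[n] p ∉ B := by
    rintro (h | h)
    · exact iterate_notMem_image_succ hφ (by rwa [image_univ]) n h
    · exact h.2 rfl
  obtain ⟨h, hh, hhB, hhp⟩ := exists_norm_le_one_eqOn_zero hB hpB
  have hgt : ∀ j > n, ∀ x, h (φ^[j] x) = 0 := fun j hj x =>
    hhB (Or.inl (iterate_mem_image_iterate (mapsTo_univ φ univ) (mem_univ x) hj))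
  refine ⟨h, hh, hhp, hgt, fun j x hx hne => ?_⟩
  rcases le_or_gt j n with hj | hj
  · exact hhB (Or.inr ⟨mem_biUnion hj (mem_image_of_mem _ hx), hne⟩)
  · exact hgt j hj x

theorem IsBoundedBelowOff.succ_mul_norm_weightProd_le (hb : IsBoundedBelowOff φ v s C)
    (hφ : Injective φ) (hs : s.Finite) (hC : 0 ≤ C) {p : X} (hp : p ∉ range φ) {k : ℕ}
    (hps : ∀ m : ℕ, φ^[m] p ∈ s → ∃ a ∈ Ico m k, v (φ^[a] p) = 0) (i : ℕ) :
    (i + 1) * ‖weightProd φ v i (φ^[k] p)‖ ≤ C * C := by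
  obtain ⟨h, hh, hp1, hgt, hne⟩ := exists_norm_le_one_apply_iterate_eq_zero hφ
    (hs.insert (φ^[k] p)) hp (k + i)
  set u : ℕ → C(X, ℂ) := fun j => (weightedComp φ v ^ j) h
  have hu_apply : ∀ j x, u j x = weightProd φ v j x * h (φ^[j] x) := fun j x =>
    weightedComp_pow_apply φ v j h x
  have hus : ∀ j, ∀ x ∈ s, u j x = 0 := by
    intro j x hx
    rw [hu_apply]
    by_cases hxp : φ^[j] x = φ^[k + i] p
    · have hj : j ≤ k + i := le_of_not_gt fun hj => by simpa [hxp, hp1] using hgt j hj x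
      exact mul_eq_zero_of_left (weightProd_eq_zero_of_iterate_eq hφ hps hx hj hxp) _
    · exact mul_eq_zero_of_right _ (hne j x (mem_insert_of_mem _ hx) hxp)
  have hval : (∑ j ∈ Finset.range (k + i + 1), (j + 1) • u j) (φ^[k] p) =
      (i + 1 : ℕ) * weightProd φ v i (φ^[k] p) := by
    rw [ContinuousMap.sum_apply, Finset.sum_eq_single_of_mem i (Finset.mem_range.2 (by omega))]
    · rw [ContinuousMap.nsmul_apply, hu_apply, ← iterate_add_apply, add_comm i k, hp1, mul_one,
        nsmul_eq_mul]
    · intro j _ hji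
      rw [ContinuousMap.nsmul_apply, hu_apply, hne j _ (mem_insert _ _), mul_zero, smul_zero]
      rw [← iterate_add_apply]
      exact fun h => hji (by have := injective_iterate_of_notMem_range hφ hp h; omega)
  calc (i + 1) * ‖weightProd φ v i (φ^[k] p)‖
      = ‖(∑ j ∈ Finset.range (k + i + 1), (j + 1) • u j) (φ^[k] p)‖ := by
        rw [hval, norm_mul, Complex.norm_natCast, Nat.cast_succ]
    _ ≤ ‖∑ j ∈ Finset.range (k + i + 1), (j + 1) • u j‖ := ContinuousMap.norm_coe_le_norm _ _
    _ ≤ C * (C * ‖u 0‖) := norm_sum_succ_smul_le hC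
        (T := (weightedComp φ v).toLinearMap.toAddMonoidHom)
        (V := AddMonoidHom.mker (restrictCLM s))
        (fun f hf => hb f (restrictCLM_eq_zero_iff.1 hf)) (fun j => by
          change _ = (weightedComp φ v ^ (j + 1)) h
          rw [pow_succ']
          rfl)
        (fun j => restrictCLM_eq_zero_iff.2 (hus j))
        (ContinuousMap.ext fun x => by rw [hu_apply, hgt _ (Nat.lt_succ_self _), mul_zero]; rfl)
    _ ≤ C * C := by
        gcongr
        exact mul_le_of_le_one_right hC hh

theorem IsBoundedBelowOff.uniformDecay (hb : IsBoundedBelowOff φ v s C) (hφ : Injective φ)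
    (hs : s.Finite) (hC : 0 ≤ C) {A : Set X}
    (hA : ∀ x ∈ A, ∃ p ∉ range φ, ∃ k : ℕ, φ^[k] p = x ∧
      ∀ m : ℕ, φ^[m] p ∈ s → ∃ a ∈ Ico m k, v (φ^[a] p) = 0) : UniformDecay φ v A := by
  intro ε hε
  filter_upwards [(tendsto_natCast_atTop_atTop (R := ℝ)).eventually_ge_atTop (C * C / ε)]
    with i hi x hx
  obtain ⟨p, hp, k, rfl, hps⟩ := hA x hx
  have hle := hb.succ_mul_norm_weightProd_le hφ hs hC hp hps i
  rw [div_le_iff₀ hε] at hi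
  have hi0 : (0 : ℝ) < i + 1 := by positivity
  exact le_of_mul_le_mul_left (by linarith) hi0

end Decay

section RealSequences

variable {P : ℕ → ℝ} {C : ℝ}

theorem le_pow_mul_of_tsum_le (hC : 1 ≤ C) (hP : ∀ n, 0 ≤ P n) (hs : Summable P)
    (h : ∀ n, ∑' j, P (n + j) ≤ C * P n) (m : ℕ) : P m ≤ (1 - C⁻¹) ^ m * (C * P 0) := by
  have hC0 : 0 < C := by linarith
  have hr : 0 ≤ 1 - C⁻¹ := sub_nonneg.2 (inv_le_one_of_one_le₀ hC)
  set R : ℕ → ℝ := fun n => ∑' j, P (n + j)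
  have hsn : ∀ n, Summable fun j => P (n + j) := fun n => by
    simpa only [add_comm] using (summable_nat_add_iff n).2 hs
  have hR : ∀ n, R n = P n + R (n + 1) := fun n =>
    (hsn n).tsum_eq_zero_add.trans (by simp only [R, add_zero, add_assoc, add_comm 1])
  calc P m ≤ R m := (hsn m).le_tsum 0 fun j _ => hP _
    _ ≤ (1 - C⁻¹) ^ m * R 0 := le_geom hr m fun k _ => by
        have : C⁻¹ * R k ≤ P k := (inv_mul_le_iff₀ hC0).2 (h k)
        linarith [hR k]
    _ ≤ (1 - C⁻¹) ^ m * (C * P 0) := by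
        gcongr
        exact h 0

theorem pow_mul_le_of_sum_range_le (hC : 0 < C) (hP : ∀ n, 0 ≤ P n)
    (h : ∀ n, ∑ j ∈ Finset.range n, P j ≤ C * P n) (n m : ℕ) :
    (1 + C⁻¹) ^ m * P n ≤ C * P (n + m + 1) := by
  set α : ℕ → ℝ := fun n => ∑ j ∈ Finset.range n, P j
  have hα : ∀ n, α (n + 1) = α n + P n := fun n => Finset.sum_range_succ _ _
  calc (1 + C⁻¹) ^ m * P n ≤ (1 + C⁻¹) ^ m * α (n + 1) := by
        gcongr
        exact (hα n).symm ▸ le_add_of_nonneg_left (Finset.sum_nonneg fun j _ => hP j)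
    _ ≤ α (n + 1 + m) := geom_le (u := fun m => α (n + 1 + m)) (by positivity) m fun k _ => by
        have : C⁻¹ * α (n + 1 + k) ≤ P (n + 1 + k) := (inv_mul_le_iff₀ hC).2 (h _)
        rw [← add_assoc, hα]
        linarith
    _ ≤ C * P (n + m + 1) := (h _).trans_eq (by rw [add_right_comm])

theorem forall_sum_range_le_or_eventually_tsum_le (hP : ∀ n, 0 < P n)
    (h : ∀ n k, min (∑ j ∈ Finset.range n, P j) (∑ j ∈ Finset.range k, P (n + j)) ≤ C * P n) :
    (∀ n, ∑ j ∈ Finset.range n, P j ≤ C * P n) ∨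
      Summable P ∧ ∀ᶠ n in atTop, ∑' j, P (n + j) ≤ C * P n := by
  have hle : ∀ n, C * P n < ∑ j ∈ Finset.range n, P j →
      ∀ k, ∑ j ∈ Finset.range k, P (n + j) ≤ C * P n :=
    fun n hn k => (min_le_iff.1 (h n k)).resolve_left hn.not_ge
  refine or_iff_not_imp_left.2 fun hnot => ?_
  push Not at hnot
  obtain ⟨n, hn⟩ := hnot
  have hs : Summable P := (summable_nat_add_iff n).1 <| by
    simpa only [add_comm] using summable_of_sum_range_le (fun j => (hP _).le) (hle n hn)
  have hlim : Tendsto (fun n => ∑ j ∈ Finset.range n, P j - C * P n) atTop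
      (𝓝 (∑' n, P n - C * 0)) :=
    hs.hasSum.tendsto_sum_nat.sub (hs.tendsto_atTop_zero.const_mul C)
  have hpos : 0 < ∑' n, P n - C * 0 := by
    simpa using hs.tsum_pos (fun n => (hP n).le) 0 (hP 0)
  refine ⟨hs, ?_⟩
  filter_upwards [hlim.eventually_const_lt hpos] with n hn
  exact Real.tsum_le_of_sum_range_le (fun j => (hP _).le) (hle n (sub_pos.1 hn))

end RealSequences

-- The test function is `W n ↦ min (α n) (β n) / W n`, where `α` increases and `β` decreases with
-- increments `‖W n‖`: it is nearly fixed by the shift, although it is large where `α = β`.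
theorem min_sum_norm_le {W w : ℕ → ℂ} {C : ℝ} (hW : ∀ n, W (n + 1) = W n * w n)
    (hW0 : ∀ n, W n ≠ 0)
    (H : ∀ f : ℕ → ℂ, (support f).Finite → f 0 = 0 → (∀ n, ‖f n - w n * f (n + 1)‖ ≤ 1) →
      ∀ n, ‖f n‖ ≤ C) (n k : ℕ) :
    min (∑ j ∈ Finset.range n, ‖W j‖) (∑ j ∈ Finset.range k, ‖W (n + j)‖) ≤ C * ‖W n‖ := by
  set α : ℕ → ℝ := fun m => ∑ j ∈ Finset.range m, ‖W j‖
  set β : ℕ → ℝ := fun m => ∑ j ∈ Finset.Ico m (n + k), ‖W j‖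
  have hα : ∀ m, 0 ≤ α m := fun m => by positivity
  have hβ : ∀ m, 0 ≤ β m := fun m => by positivity
  have hαs : ∀ m, |α m - α (m + 1)| ≤ ‖W m‖ := fun m => by
    simp only [α, Finset.sum_range_succ, sub_add_cancel_left, abs_neg, abs_norm, le_refl]
  have hβs : ∀ m, |β m - β (m + 1)| ≤ ‖W m‖ := fun m => by
    rcases lt_or_ge m (n + k) with hm | hm
    · simp only [β, Finset.sum_eq_sum_Ico_succ_bot hm, add_sub_cancel_right, abs_norm, le_refl]
    · simp [β, Finset.Ico_eq_empty_of_le hm, Finset.Ico_eq_empty_of_le (Nat.le_succ_of_le hm)]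
  set f : ℕ → ℂ := fun m => (min (α m) (β m) : ℝ) / W m
  have hf : (support f).Finite := (finite_Iio (n + k)).subset fun m hm => by
    refine mem_Iio.2 (lt_of_not_ge fun hmk => hm ?_)
    simp only [f, β, Finset.Ico_eq_empty_of_le hmk, Finset.sum_empty, min_eq_right (hα m),
      Complex.ofReal_zero, zero_div]
  have hfw : ∀ m, ‖f m - w m * f (m + 1)‖ ≤ 1 := fun m => by
    have hw0 : w m ≠ 0 := right_ne_zero_of_mul ((hW m).symm ▸ hW0 (m + 1))
    have hfm : f m - w m * f (m + 1) =
        ((min (α m) (β m) - min (α (m + 1)) (β (m + 1)) : ℝ) : ℂ) / W m := by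
      have := hW0 m
      simp only [f, hW]
      push_cast
      field_simp
    rw [hfm, norm_div, Complex.norm_real, Real.norm_eq_abs, div_le_one (norm_pos_iff.2 (hW0 m))]
    exact (abs_min_sub_min_le_max _ _ _ _).trans (max_le (hαs m) (hβs m))
  have hfn := H f hf (by simp [f, α, hβ 0]) hfw n
  rw [norm_div, Complex.norm_real, Real.norm_eq_abs, abs_of_nonneg (le_min (hα n) (hβ n)),
    div_le_iff₀ (norm_pos_iff.2 (hW0 n))] at hfn
  simpa only [α, β, Finset.sum_Ico_eq_sum_range, Nat.add_sub_cancel_left] using hfn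

section Trajectory

variable {X : Type*} {φ : X → X} {v : X → ℂ}

theorem uniformDecay_or_uniformGrowth_of_norm_le {C : ℝ} (hC : 1 ≤ C) {x : X}
    (hx : ∀ n, v (φ^[n] x) ≠ 0)
    (H : ∀ f : ℕ → ℂ, (support f).Finite → f 0 = 0 →
      (∀ n, ‖f n - v (φ^[n] x) * f (n + 1)‖ ≤ 1) → ∀ n, ‖f n‖ ≤ C) :
    (∃ N : ℕ, UniformDecay φ v (trajectory φ (φ^[N] x))) ∨ UniformGrowth φ v (trajectory φ x) := by
  have hC0 : 0 < C := by linarith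
  set W : ℕ → ℂ := fun n => weightProd φ v n x
  have hW0 : ∀ n, W n ≠ 0 := fun n => Finset.prod_ne_zero_iff.2 fun j _ => hx j
  have hP : ∀ n, 0 < ‖W n‖ := fun n => norm_pos_iff.2 (hW0 n)
  have hWm : ∀ n m, ‖W (n + m)‖ = ‖weightProd φ v m (φ^[n] x)‖ * ‖W n‖ := fun n m => by
    rw [← norm_mul, mul_comm, ← weightProd_add]
  have hmin := min_sum_norm_le (W := W) (fun n => Finset.prod_range_succ _ n) hW0 H
  rcases forall_sum_range_le_or_eventually_tsum_le hP hmin with hα | ⟨hs, hβ⟩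
  · refine Or.inr fun R => ?_
    have hlim := tendsto_pow_atTop_atTop_of_one_lt (lt_add_of_pos_right 1 (inv_pos.2 hC0))
    filter_upwards [(tendsto_sub_atTop_nat 1).eventually (hlim.eventually_ge_atTop (C * R)),
      eventually_ge_atTop 1] with m hm hm1
    rintro _ ⟨n, rfl⟩
    have hle := pow_mul_le_of_sum_range_le hC0 (fun n => (hP n).le) hα n (m - 1)
    rw [add_assoc, Nat.sub_add_cancel hm1, hWm, ← mul_assoc] at hle
    exact le_of_mul_le_mul_left (hm.trans (le_of_mul_le_mul_right hle (hP n))) hC0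
  · obtain ⟨N, hN⟩ := eventually_atTop.1 hβ
    refine Or.inl ⟨N, fun ε hε => ?_⟩
    have hlim : Tendsto (fun m : ℕ => (1 - C⁻¹) ^ m * C) atTop (𝓝 0) := by
      simpa using (tendsto_pow_atTop_nhds_zero_of_lt_one (sub_nonneg.2 (inv_le_one_of_one_le₀ hC))
        (sub_lt_self _ (inv_pos.2 hC0))).mul_const C
    filter_upwards [hlim.eventually_le_const hε] with m hm
    rintro _ ⟨n, rfl⟩
    have hle := le_pow_mul_of_tsum_le (P := fun j => ‖W (n + N + j)‖) hC (fun j => (hP _).le)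
      (by simpa only [add_comm _ (n + N)] using (summable_nat_add_iff (n + N)).2 hs)
      (fun j => by simpa only [add_assoc] using hN (n + N + j) (by omega)) m
    rw [hWm, add_zero, ← mul_assoc, iterate_add_apply] at hle
    exact (le_of_mul_le_mul_right hle (hP _)).trans hm

theorem UniformDecay.trajectory_of_iterate {B : ℝ} (hv : ∀ y, ‖v y‖ ≤ B) {x : X} {k : ℕ}
    (h : UniformDecay φ v (trajectory φ (φ^[k] x))) : UniformDecay φ v (trajectory φ x) := by
  refine UniformDecay.of_image_iterate hv k (h.mono ?_)
  rintro _ ⟨_, ⟨n, rfl⟩, rfl⟩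
  exact ⟨n, by simp only [← iterate_add_apply, add_comm]⟩

end Trajectory

section Isolated

variable {X : Type*} [TopologicalSpace X] [CompactSpace X] [T2Space X] {φ : C(X, X)} {v : C(X, ℂ)}
  {s : Set X} {C : ℝ}

theorem IsBoundedBelowOff.norm_le_of_isOpen_singleton (hb : IsBoundedBelowOff φ v s C)
    (hφ : Injective φ) (hC : 0 ≤ C) {x : X} (hx : Injective fun n : ℕ => φ^[n] x)
    (hiso : ∀ n : ℕ, IsOpen {φ^[n] x}) (hxs : ∀ n : ℕ, φ^[n] x ∈ s → n = 0) {f : ℕ → ℂ}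
    (hf : (support f).Finite) (hf0 : f 0 = 0)
    (hfv : ∀ n : ℕ, ‖f n - v (φ^[n] x) * f (n + 1)‖ ≤ 1) (n : ℕ) : ‖f n‖ ≤ C := by
  obtain ⟨F, hF, hF0⟩ := exists_continuousMap_of_tendsto_cofinite hx hiso
    (tendsto_nhds_of_eventually_eq hf)
  have hFs : EqOn F 0 s := fun y hy => by
    by_cases hyx : y ∈ range fun n : ℕ => φ^[n] x
    · obtain ⟨j, rfl⟩ := hyx
      obtain rfl := hxs j hy
      exact (hF 0).trans hf0
    · exact hF0 y hyx
  have hFφ : ∀ y ∉ range fun n : ℕ => φ^[n] x, F (φ y) = 0 := fun y hy => by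
    by_cases hyx : φ y ∈ range fun n : ℕ => φ^[n] x
    · obtain ⟨_ | j, hj⟩ := hyx
      · rw [← hj, hF, hf0]
      · exact absurd ⟨j, hφ ((iterate_succ_apply' _ _ _).symm.trans hj)⟩ hy
    · exact hF0 _ hyx
  have hFv : ‖F - weightedComp φ v F‖ ≤ 1 := (ContinuousMap.norm_le _ zero_le_one).2 fun y => by
    rw [ContinuousMap.sub_apply, weightedComp_apply]
    by_cases hy : y ∈ range fun n : ℕ => φ^[n] x
    · obtain ⟨j, rfl⟩ := hy
      rw [hF j, ← iterate_succ_apply' φ j x, hF (j + 1)]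
      exact hfv j
    · simp [hF0 y hy, hFφ y hy]
  calc ‖f n‖ = ‖F (φ^[n] x)‖ := by rw [hF]
    _ ≤ ‖F‖ := F.norm_coe_le_norm _
    _ ≤ C * ‖F - weightedComp φ v F‖ := hb F hFs
    _ ≤ C := mul_le_of_le_one_right hC hFv

theorem IsBoundedBelowOff.uniformDecay_or_uniformGrowth (hb : IsBoundedBelowOff φ v s C)
    (hφ : Injective φ) (hs : s.Finite) (hC : 1 ≤ C) {p : X} (hp : p ∉ range φ)
    (hiso : ∀ n : ℕ, IsOpen {φ^[n] p}) :
    UniformDecay φ v (trajectory φ p) ∨ ∃ N : ℕ, UniformGrowth φ v (trajectory φ (φ^[N] p)) := by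
  have hinj := injective_iterate_of_notMem_range hφ hp
  obtain ⟨N, hN⟩ := (hs.preimage hinj.injOn).bddAbove
  have hN : ∀ m, φ^[m] p ∈ s → m ≤ N := fun m hm => hN hm
  by_cases hv : ∃ a ≥ N, v (φ^[a] p) = 0
  · obtain ⟨a, ha, hva⟩ := hv
    refine Or.inl (UniformDecay.trajectory_of_iterate v.norm_coe_le_norm (k := a + 1)
      (hb.uniformDecay hφ hs (zero_le_one.trans hC) ?_))
    rintro _ ⟨n, rfl⟩
    exact ⟨p, hp, n + (a + 1), iterate_add_apply _ _ _ _, fun m hm =>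
      ⟨a, ⟨(hN m hm).trans ha, by omega⟩, hva⟩⟩
  · push Not at hv
    have hxn : ∀ n : ℕ, φ^[n] (φ^[N] p) = φ^[n + N] p := fun n => (iterate_add_apply _ _ _ _).symm
    rcases uniformDecay_or_uniformGrowth_of_norm_le hC (x := φ^[N] p) (φ := φ) (v := v)
      (fun n => hxn n ▸ hv _ (Nat.le_add_left N n)) (fun f hf hf0 hfv =>
        hb.norm_le_of_isOpen_singleton hφ (zero_le_one.trans hC)
          (by simp only [hxn]; exact hinj.comp (add_left_injective N))
          (fun n => hxn n ▸ hiso _) (fun n hn => by have := hN _ (hxn n ▸ hn); omega) hf hf0 hfv)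
      with ⟨k, hk⟩ | h
    · exact Or.inl ((hk.trajectory_of_iterate v.norm_coe_le_norm).trajectory_of_iterate
        v.norm_coe_le_norm)
    · exact Or.inr ⟨N, h⟩

end Isolated

section StartingPoints

variable {X : Type*} {φ : X → X}

theorem mapsTo_biUnion_trajectory (Y : Set X) :
    MapsTo φ (⋃ p ∈ Y, trajectory φ p) (⋃ p ∈ Y, trajectory φ p) :=
  mapsTo_iUnion₂_iUnion₂ fun p _ => mapsTo_trajectory p

theorem compl_setL_eq_biUnion_trajectory (hφ : Injective φ) :
    (setL φ)ᶜ = ⋃ p ∈ (range φ)ᶜ, trajectory φ p := by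
  have h : univ \ setL φ = _ := diff_iterInter_eq_biUnion_trajectory hφ (mapsTo_univ φ univ)
  rwa [← compl_eq_univ_sdiff, ← compl_eq_univ_sdiff, image_univ] at h

theorem finite_setOf_iterate_mem (hφ : Injective φ) {s : Set X} (hs : s.Finite) :
    {p | p ∉ range φ ∧ ∃ n : ℕ, φ^[n] p ∈ s}.Finite := by
  refine (hs.biUnion (t := fun y => {p | p ∉ range φ ∧ ∃ n : ℕ, φ^[n] p = y}) fun y _ =>
    Set.Subsingleton.finite ?_).subset fun p ⟨hp, n, hn⟩ => mem_biUnion hn ⟨hp, n, rfl⟩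
  have hdiff : ∀ p ∉ range φ, p ∈ univ \ φ '' univ := fun p hp =>
    ⟨mem_univ p, by rwa [image_univ]⟩
  rintro p ⟨hp, m, hm⟩ q ⟨hq, n, hn⟩
  exact (iterate_inj_of_notMem_image hφ (mapsTo_univ φ univ) (hdiff p hp) (hdiff q hq)
    (hm.trans hn.symm)).1

theorem UniformGrowth.biUnion_of_exists_iterate {v : X → ℂ} {Y : Set X} (hY : Y.Finite)
    (h : ∀ p ∈ Y, ∃ N : ℕ, UniformGrowth φ v (trajectory φ (φ^[N] p))) :
    ∃ N : ℕ, UniformGrowth φ v (φ^[N] '' ⋃ p ∈ Y, trajectory φ p) := by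
  choose! N hN using h
  obtain ⟨K, hK⟩ := (hY.image N).bddAbove
  refine ⟨K, (UniformGrowth.biUnion hY hN).mono ?_⟩
  rintro _ ⟨x, hx, rfl⟩
  obtain ⟨p, hp, n, rfl⟩ := mem_iUnion₂.1 hx
  have hNK : N p ≤ K := hK (mem_image_of_mem N hp)
  refine mem_biUnion hp ⟨K - N p + n, ?_⟩
  simp only [← iterate_add_apply]
  congr 1
  omega

-- Outside `φⁿ⁺¹(X)` and away from the trajectories that start outside `F`, only the finitely many
-- points `φʲ(q)` with `q ∈ F` and `j ≤ n` remain.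
theorem isOpen_singleton_iterate [TopologicalSpace X] [CompactSpace X] [T2Space X]
    (hφc : Continuous φ) (hφ : Injective φ) {F : Set X} (hF : F.Finite) {p : X} (hp : p ∉ range φ)
    (hpF : ∀ k : ℕ, φ^[k] p ∉ closure (⋃ q ∈ (range φ)ᶜ \ F, trajectory φ q)) (n : ℕ) :
    IsOpen {φ^[n] p} := by
  set G : Set X := ⋃ q ∈ (range φ)ᶜ \ F, trajectory φ q
  refine isOpen_singleton_of_finite_mem_nhds _ (s := (φ^[n + 1] '' univ)ᶜ ∩ (closure G)ᶜ)
    (((isCompact_univ.image (hφc.iterate _)).isClosed.isOpen_compl.inter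
      isClosed_closure.isOpen_compl).mem_nhds ⟨?_, hpF n⟩)
    (((finite_Iic n).biUnion fun j _ => hF.image φ^[j]).subset ?_)
  · exact iterate_notMem_image_succ hφ (by rwa [image_univ]) n
  · rintro x ⟨hx, hxG⟩
    have hxL : x ∈ (setL φ)ᶜ := fun hxL => hx (mem_iInter.1 hxL (n + 1))
    rw [compl_setL_eq_biUnion_trajectory hφ] at hxL
    obtain ⟨q, hq, j, rfl⟩ := mem_iUnion₂.1 hxL
    have hqF : q ∈ F := by
      by_contra hqF
      exact hxG (subset_closure (mem_biUnion ⟨hq, hqF⟩ ⟨j, rfl⟩))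
    have hjn : j ≤ n := not_lt.1 fun hnj =>
      hx (iterate_mem_image_iterate (mapsTo_univ φ univ) (mem_univ q) hnj)
    exact mem_biUnion hjn (mem_image_of_mem _ hqF)

end StartingPoints

section Splitting

variable {X : Type*} [TopologicalSpace X] [CompactSpace X] [T2Space X] {φ : C(X, X)} {v : C(X, ℂ)}

theorem IsBoundedBelowOff.exists_finite_uniformDecay_uniformGrowth {s : Set X} {C : ℝ}
    (hb : IsBoundedBelowOff φ v s C) (hφ : Injective φ) (hs : s.Finite) (hC : 1 ≤ C) :
    ∃ Y ⊆ (range φ)ᶜ, Y.Finite ∧ UniformDecay φ v (⋃ p ∈ (range φ)ᶜ \ Y, trajectory φ p) ∧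
      ∃ N : ℕ, UniformGrowth φ v (φ^[N] '' ⋃ p ∈ Y, trajectory φ p) := by
  set F : Set X := {p | p ∉ range φ ∧ ∃ n : ℕ, φ^[n] p ∈ s}
  set Y : Set X := {p ∈ F | ∃ N : ℕ, UniformGrowth φ v (trajectory φ (φ^[N] p))}
  set G : Set X := ⋃ p ∈ (range φ)ᶜ \ F, trajectory φ p
  have hF : F.Finite := finite_setOf_iterate_mem hφ hs
  have hY : Y.Finite := hF.subset (sep_subset _ _)
  have hG : UniformDecay φ v G := hb.uniformDecay hφ hs (zero_le_one.trans hC) fun x hx => by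
    obtain ⟨p, ⟨hp, hpF⟩, n, rfl⟩ := mem_iUnion₂.1 hx
    exact ⟨p, hp, n, rfl, fun m hm => absurd ⟨hp, m, hm⟩ hpF⟩
  have hFY : ∀ p ∈ F \ Y, UniformDecay φ v (trajectory φ p) := by
    rintro p ⟨hpF, hpY⟩
    by_cases hk : ∃ k : ℕ, φ^[k] p ∈ closure G
    · obtain ⟨k, hk⟩ := hk
      exact UniformDecay.trajectory_of_iterate v.norm_coe_le_norm
        ((hG.closure φ.continuous v.continuous).mono
          (trajectory_subset ((mapsTo_biUnion_trajectory _).closure φ.continuous) hk))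
    · push Not at hk
      exact (hb.uniformDecay_or_uniformGrowth hφ hs hC hpF.1
        (isOpen_singleton_iterate φ.continuous hφ hF hpF.1 hk)).resolve_right
          fun h => hpY ⟨hpF, h⟩
  refine ⟨Y, fun p hp => hp.1.1, hY, ?_,
    UniformGrowth.biUnion_of_exists_iterate hY fun p hp => hp.2⟩
  refine (hG.union (UniformDecay.biUnion (hF.subset sdiff_subset) hFY)).mono ?_
  refine iUnion₂_subset fun p hp => ?_
  by_cases hpF : p ∈ F
  · exact subset_union_of_subset_right
      (subset_biUnion_of_mem (u := trajectory φ) (show p ∈ F \ Y from ⟨hpF, hp.2⟩)) _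
  · exact subset_union_of_subset_left
      (subset_biUnion_of_mem (u := trajectory φ) (show p ∈ (range φ)ᶜ \ F from ⟨hp.1, hpF⟩)) _

theorem isHyperbolicSplitting_closure (hφ : Injective φ) {Y : Set X} (hYφ : Y ⊆ (range φ)ᶜ)
    (hY : Y.Finite) (hdecay : UniformDecay φ v (⋃ p ∈ (range φ)ᶜ \ Y, trajectory φ p)) {N : ℕ}
    (hgrowth : UniformGrowth φ v (φ^[N] '' ⋃ p ∈ Y, trajectory φ p)) :
    IsHyperbolicSplitting φ v (closure (⋃ p ∈ (range φ)ᶜ \ Y, trajectory φ p))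
      (closure (⋃ p ∈ Y, trajectory φ p)) := by
  set D : Set X := ⋃ p ∈ (range φ)ᶜ \ Y, trajectory φ p
  set E : Set X := ⋃ p ∈ Y, trajectory φ p
  have hmaps : ∀ Z : Set X, MapsTo φ (closure (⋃ p ∈ Z, trajectory φ p))
      (closure (⋃ p ∈ Z, trajectory φ p)) :=
    fun Z => (mapsTo_biUnion_trajectory Z).closure φ.continuous
  have hdecay' : UniformDecay φ v (closure D) := hdecay.closure φ.continuous v.continuous
  have hgrowth' : UniformGrowth φ v (φ^[N] '' closure E) :=
    (hgrowth.closure φ.continuous v.continuous).mono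
      (image_closure_subset_closure_image (φ.continuous.iterate N))
  refine ⟨?_, ?_, isClosed_closure, isClosed_closure, hmaps _, hmaps _, hdecay',
    hgrowth'.mono fun x hx => mem_iInter.1 hx N, ?_⟩
  · rw [setM_eq_closure, compl_setL_eq_biUnion_trajectory hφ, ← closure_union, ← biUnion_union,
      sdiff_union_of_subset hYφ]
  · exact Set.disjoint_left.2 fun x hxD hxE =>
      Set.disjoint_left.1 (hdecay'.disjoint_of_uniformGrowth hgrowth')
        ((hmaps _).iterate N hxD) (mem_image_of_mem _ hxE)
  · have hE : closure E ⊆ Y ∪ φ '' closure E := by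
      refine closure_minimal (iUnion₂_subset fun p hp => ?_)
        (hY.isClosed.union (isClosed_closure.isCompact.image φ.continuous).isClosed)
      rintro _ ⟨_ | n, rfl⟩
      · exact Or.inl hp
      · exact Or.inr ⟨φ^[n] p, subset_closure (mem_biUnion hp ⟨n, rfl⟩),
          (iterate_succ_apply' _ _ _).symm⟩
    exact hY.subset fun x hx => (hE hx.1).resolve_right hx.2

theorem IsUpperSemiFredholm.exists_isHyperbolicSplitting (hφ : Injective φ)
    (h : IsUpperSemiFredholm (ContinuousLinearMap.id ℂ C(X, ℂ) - weightedComp φ v)) :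
    ∃ M₁ M₂ : Set X, IsHyperbolicSplitting φ v M₁ M₂ := by
  obtain ⟨s, hs, C, hC, hb⟩ := h.exists_isBoundedBelowOff
  obtain ⟨Y, hYφ, hY, hdecay, N, hgrowth⟩ := hb.exists_finite_uniformDecay_uniformGrowth hφ hs hC
  exact ⟨_, _, isHyperbolicSplitting_closure hφ hYφ hY hdecay hgrowth⟩

end Splitting

section Scaling

variable {E : Type*} [AddCommGroup E] [Module ℂ E] [TopologicalSpace E]
  [ContinuousConstSMul ℂ E] (S : E →L[ℂ] E) {c : ℂ}

theorem ker_smul_eq (hc : c ≠ 0) :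
    LinearMap.ker ((c • S : E →L[ℂ] E) : E →ₗ[ℂ] E) = LinearMap.ker (S : E →ₗ[ℂ] E) :=
  LinearMap.ker_smul (S : E →ₗ[ℂ] E) c hc

theorem isUpperSemiFredholm_smul_iff (hc : c ≠ 0) :
    IsUpperSemiFredholm (c • S) ↔ IsUpperSemiFredholm S := by
  have hrange : range (c • S : E →L[ℂ] E) = range S :=
    congrArg SetLike.coe (LinearMap.range_smul (S : E →ₗ[ℂ] E) c hc)
  rw [IsUpperSemiFredholm, IsUpperSemiFredholm, ker_smul_eq S hc, hrange]

end Scaling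

section Main

variable {X : Type*} [TopologicalSpace X] (φ : C(X, X)) (w : C(X, ℂ)) {c : ℂ}

theorem smul_id_sub_weightedComp (hc : c ≠ 0) :
    c • ContinuousLinearMap.id ℂ C(X, ℂ) - weightedComp φ w =
      c • (ContinuousLinearMap.id ℂ C(X, ℂ) - weightedComp φ (c⁻¹ • w)) := by
  ext f x
  change c * f x - w x * f (φ x) = c * (f x - c⁻¹ * w x * f (φ x))
  field_simp

theorem smul_id_sub_weightedCompOn {A : Set X} (hA : MapsTo φ A A) (hc : c ≠ 0) :
    c • ContinuousLinearMap.id ℂ C(A, ℂ) - weightedCompOn φ w A hA =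
      c • (ContinuousLinearMap.id ℂ C(A, ℂ) - weightedCompOn φ (c⁻¹ • w) A hA) :=
  smul_id_sub_weightedComp _ _ hc

theorem theorem2_general {K : Type*} [TopologicalSpace K] [CompactSpace K] [T2Space K]
    (φ : C(K, K)) (hφ : Injective φ) (w : C(K, ℂ)) (lam : ℂ) (hlam : lam ≠ 0) :
    (IsUpperSemiFredholm
        (lam • ContinuousLinearMap.id ℂ C(K, ℂ) - weightedComp φ w) ↔
      IsUpperSemiFredholm (lam • ContinuousLinearMap.id ℂ C(setL φ, ℂ) -
          weightedCompOn φ w (setL φ) (mapsTo_setL φ)) ∧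
        ∃ M₁ M₂ : Set K, IsSplitting φ w lam M₁ M₂) ∧
    (IsUpperSemiFredholm
        (lam • ContinuousLinearMap.id ℂ C(K, ℂ) - weightedComp φ w) →
      ∀ M₁ M₂ : Set K, IsSplitting φ w lam M₁ M₂ →
        Module.finrank ℂ (LinearMap.ker ((lam • ContinuousLinearMap.id ℂ C(K, ℂ) -
            weightedComp φ w : C(K, ℂ) →L[ℂ] C(K, ℂ)) : C(K, ℂ) →ₗ[ℂ] C(K, ℂ))) =
          Module.finrank ℂ (LinearMap.ker ((lam • ContinuousLinearMap.id ℂ C(setL φ, ℂ) -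
            weightedCompOn φ w (setL φ) (mapsTo_setL φ) :
              C(setL φ, ℂ) →L[ℂ] C(setL φ, ℂ)) : C(setL φ, ℂ) →ₗ[ℂ] C(setL φ, ℂ))) +
          (M₂ \ φ '' M₂).ncard) := by
  rw [smul_id_sub_weightedComp φ w hlam, smul_id_sub_weightedCompOn φ w _ hlam,
    isUpperSemiFredholm_smul_iff _ hlam, isUpperSemiFredholm_smul_iff _ hlam,
    ker_smul_eq _ hlam, ker_smul_eq _ hlam]
  simp only [isSplitting_iff_isHyperbolicSplitting hφ hlam]
  refine ⟨⟨fun h => ?_, fun ⟨hL, M₁, M₂, hM⟩ => (hM.isUpperSemiFredholm_iff hφ).2 hL⟩,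
    fun h M₁ M₂ hM => ?_⟩
  · obtain ⟨M₁, M₂, hM⟩ := h.exists_isHyperbolicSplitting hφ
    exact ⟨(hM.isUpperSemiFredholm_iff hφ).1 h, M₁, M₂, hM⟩
  · have := ((hM.isUpperSemiFredholm_iff hφ).1 h).1
    exact hM.finrank_ker_eq hφ

end Main

theorem theorem2 {K : Type*} [TopologicalSpace K] [CompactSpace K] [T2Space K]
    (φ : C(K, K)) (hφ : Topology.IsEmbedding φ) (hφ' : range φ ≠ univ) (w : C(K, ℂ))
    (lam : ℂ) (hlam : lam ∈ spectrum ℂ (weightedComp φ w)) (hlam' : lam ≠ 0) :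
    (IsUpperSemiFredholm
        (lam • ContinuousLinearMap.id ℂ C(K, ℂ) - weightedComp φ w) ↔
      IsUpperSemiFredholm (lam • ContinuousLinearMap.id ℂ C(setL φ, ℂ) -
          weightedCompOn φ w (setL φ) (mapsTo_setL φ)) ∧
        ∃ M₁ M₂ : Set K, IsSplitting φ w lam M₁ M₂) ∧
    (IsUpperSemiFredholm
        (lam • ContinuousLinearMap.id ℂ C(K, ℂ) - weightedComp φ w) →
      ∀ M₁ M₂ : Set K, IsSplitting φ w lam M₁ M₂ →
        Module.finrank ℂ (LinearMap.ker ((lam • ContinuousLinearMap.id ℂ C(K, ℂ) -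
            weightedComp φ w : C(K, ℂ) →L[ℂ] C(K, ℂ)) : C(K, ℂ) →ₗ[ℂ] C(K, ℂ))) =
          Module.finrank ℂ (LinearMap.ker ((lam • ContinuousLinearMap.id ℂ C(setL φ, ℂ) -
            weightedCompOn φ w (setL φ) (mapsTo_setL φ) :
              C(setL φ, ℂ) →L[ℂ] C(setL φ, ℂ)) : C(setL φ, ℂ) →ₗ[ℂ] C(setL φ, ℂ))) +
          (M₂ \ φ '' M₂).ncard) :=
  theorem2_general φ hφ.injective w lam hlam'
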